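/- Let $E$ be a complex Banach space whose dual $E'$ is (norm) separable, let $k\in(1,+\infty]$ and $A\in[0,+\infty)$. For $f$ holomorphic near $a\in E$ with values in $\mathbb C$, with $f(x)=\sum_m P_m(x-a)$, $P_m$ continuous $m$-homogeneous polynomials, write $\hat d^mf(a)=m!\,P_m$ (and $df(x)a$ for the derivative of $f$ at $x$ in the direction $a$). Let $\Theta=(\mathcal P_\Theta({}^jE))_{j\ge 0}$ be a holomorphy type from $E$ to $\mathbb C$: each $\mathcal P_\Theta({}^jE)$ is a linear subspace of the space $\mathcal P({}^jE)$ of continuous $j$-homogeneous polynomials $E\to\mathbb C$ and is a Banach space for a norm $\|\cdot\|_\Theta$; $\mathcal P_\Theta({}^0E)=\mathbb C$ as a normed space; and there is $\sigma\ge1$ such that for all $0\le m\le j$, $a\in E$, $P\in\mathcal P_\Theta({}^jE)$ one has $\hat d^mP(a)\in\mathcal P_\Theta({}^mE)$ and $\|\frac1{m!}\hat d^mP(a)\|_\Theta\le\sigma^j\|P\|_\Theta\|a\|^{j-m}$. Assume that * $\Theta$ has canonical constants: $\|\frac1{m!}\hat d^mP(a)\|_\Theta\le\binom jm\|P\|_\Theta\|a\|^{j-m}$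 for all $0\le m\le j$, $a\in E$, $P\in\mathcal P_\Theta({}^jE)$; * $\Theta$ is a $\pi_1$-holomorphy type: for every $j\ge 0$, the space $\mathcal P_f({}^jE)$ of finite type polynomials (the linear span of the $\phi^j$, $\phi\in E'$) is contained and $\|\cdot\|_\Theta$-dense in $\mathcal P_\Theta({}^jE)$, and there is $K>0$ with $\|\phi^j b\|_\Theta\le K^j\|\phi\|^j|b|$ for all $\phi\in E'$, $b\in\mathbb C$, $j\ge 0$. For $k<\infty$ let $Exp^k_{\Theta,0,A}(E)$ be the space of all entire $f\colon E\to\mathbb C$ with $\hat d^jf(0)\in\mathcal P_\Theta({}^jE)$ for all $j$ and $$\|f\|_{\Theta,k,\rho}=\sum_{j=0}^\infty\rho^{-j}\Big(\frac j{ke}\Big)^{j/k}\Big\|\frac1{j!}\hat d^jf(0)\Big\|_\Theta<\infty\quad\text{for every }\rho>A$$ (the factor $(j/(ke))^{j/k}$ being $1$ for $j=0$), with the locally convex topology given by these norms. Let $Exp^\infty_{\Theta,0,A}(E)$ be the space of all $f$ holomorphic on the open ball $B_{1/A}(0)$ of $E$ (on $E$ if $A=0$) with $\hat d^jf(0)\in\mathcal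 P_\Theta({}^jE)$ for all $j$ and $\limsup_{j\to\infty}\|\frac1{j!}\hat d^jf(0)\|_\Theta^{1/j}\le A$, with the locally convex topology given by the norms $\sum_{j}\rho^{-j}\|\frac1{j!}\hat d^jf(0)\|_\Theta$, $\rho>A$. A convolution operator on $X=Exp^k_{\Theta,0,A}(E)$ is a continuous linear operator $L\colon X\to X$ with $d(Lf)(\cdot)a=L(df(\cdot)a)$ for all $a\in E$ and $f\in X$ (under the above assumptions $df(\cdot)a\in X$); it is nontrivial if it is not a scalar multiple of the identity. Then every nontrivial convolution operator $L$ on $X$ is mixing, that is, for all non-empty open $U,V\subset X$ there is $n_0$ with $L^n(U)\cap V\ne\emptyset$ for all $n\ge n_0$; and it is hypercyclic, that is, some orbit $\{f,Lf,L^2f,\dots\}$ is dense in $X$. -/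

import Mathlib

open Filter Topology
open scoped NNReal ENNReal

noncomputable section

namespace HoloConv

section Polynomials

variable (E : Type*) [NormedAddCommGroup E] [NormedSpace ℂ E]

/-- The space of continuous `j`-homogeneous polynomials `E → ℂ`: the functions
`x ↦ B (x, …, x)` with `B` a continuous `j`-linear form. -/
def homPoly (j : ℕ) : Submodule ℂ (E → ℂ) where
  carrier := {P | ∃ B : ContinuousMultilinearMap ℂ (fun _ : Fin j => E) ℂ,
    ∀ x, P x = B (fun _ => x)}
  zero_mem' := ⟨0, fun _ => rfl⟩
  add_mem' := by
    rintro P Q ⟨B, hB⟩ ⟨C, hC⟩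
    exact ⟨B + C, fun x => by simp [hB, hC]⟩
  smul_mem' := by
    rintro c P ⟨B, hB⟩
    exact ⟨c • B, fun x => by simp [hB]⟩

/-- The space of `j`-homogeneous polynomials of finite type: the linear span of the
polynomials `x ↦ φ(x)^j b` with `φ ∈ E'` and `b ∈ ℂ`. -/
def finiteTypePoly (j : ℕ) : Submodule ℂ (E → ℂ) :=
  Submodule.span ℂ {P | ∃ (φ : StrongDual ℂ E) (b : ℂ), P = fun x => φ x ^ j * b}

end Polynomials

variable {E : Type*} [NormedAddCommGroup E] [NormedSpace ℂ E]

/-- The `n`-th derivative `d̂ⁿf(a)` of `f` at `a`, as a homogeneous polynomial: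
if `f(x) = ∑ Pₙ(x - a)` near `a`, this is `n! Pₙ`. -/
def dhat (n : ℕ) (f : E → ℂ) (a : E) : E → ℂ :=
  fun x => iteratedFDeriv ℂ n f a (fun _ => x)

/-- The `n`-th Taylor polynomial term `(1/n!) d̂ⁿf(a)`. -/
def taylor (n : ℕ) (f : E → ℂ) (a : E) : E → ℂ :=
  (n.factorial : ℂ)⁻¹ • dhat n f a

/-- A holomorphy type from `E` to `ℂ`. The value of `norm j` matters only on `poly j`. -/
structure HolomorphyType (E : Type*) [NormedAddCommGroup E] [NormedSpace ℂ E] where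
  /-- the space `P_Θ(ʲE)` -/
  poly : ℕ → Submodule ℂ (E → ℂ)
  /-- the norm of `P_Θ(ʲE)` -/
  norm : ℕ → (E → ℂ) → ℝ
  poly_le : ∀ j, poly j ≤ homPoly E j
  norm_nonneg : ∀ j, ∀ P ∈ poly j, 0 ≤ norm j P
  norm_add_le : ∀ j, ∀ P ∈ poly j, ∀ Q ∈ poly j, norm j (P + Q) ≤ norm j P + norm j Q
  norm_smul : ∀ j, ∀ (c : ℂ), ∀ P ∈ poly j, norm j (c • P) = ‖c‖ * norm j P
  eq_zero_of_norm : ∀ j, ∀ P ∈ poly j, norm j P = 0 → P = 0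
  /-- each `P_Θ(ʲE)` is complete -/
  complete : ∀ j, ∀ u : ℕ → E → ℂ, (∀ n, u n ∈ poly j) →
    (∀ ε > 0, ∃ N, ∀ m ≥ N, ∀ n ≥ N, norm j (u m - u n) < ε) →
    ∃ P ∈ poly j, Tendsto (fun n => norm j (u n - P)) atTop (𝓝 0)
  /-- `P_Θ(⁰E)` is `ℂ` as a normed space -/
  poly_zero : poly 0 = homPoly E 0
  norm_const : ∀ b : ℂ, norm 0 (fun _ => b) = ‖b‖
  dhat_mem : ∀ k j, k ≤ j → ∀ a : E, ∀ P ∈ poly j, dhat k P a ∈ poly k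
  norm_dhat_le : ∃ σ : ℝ, 1 ≤ σ ∧ ∀ k j, k ≤ j → ∀ a : E, ∀ P ∈ poly j,
    norm k (taylor k P a) ≤ σ ^ j * norm j P * ‖a‖ ^ (j - k)

namespace HolomorphyType

/-- The derivative inequality holds with the binomial coefficient in place of `σ ^ j`. -/
def HasCanonicalConstants (Θ : HolomorphyType E) : Prop :=
  ∀ k j, k ≤ j → ∀ a : E, ∀ P ∈ Θ.poly j,
    Θ.norm k (taylor k P a) ≤ (j.choose k : ℝ) * Θ.norm j P * ‖a‖ ^ (j - k)

/-- `π₁`-holomorphy types. -/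
structure IsPiOne (Θ : HolomorphyType E) : Prop where
  finiteType_le : ∀ j, finiteTypePoly E j ≤ Θ.poly j
  norm_pow_le : ∃ K : ℝ, 0 < K ∧ ∀ (φ : StrongDual ℂ E) (b : ℂ) (j : ℕ),
    Θ.norm j (fun x => φ x ^ j * b) ≤ K ^ j * ‖φ‖ ^ j * ‖b‖
  dense : ∀ j, ∀ P ∈ Θ.poly j, ∀ ε > 0, ∃ Q ∈ finiteTypePoly E j, Θ.norm j (P - Q) < ε

end HolomorphyType

/-- The domain of the functions of order `k` and type `A`: all of `E` for finite `k`, and the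
open ball of radius `1/A` about the origin (all of `E` when `A = 0`) for `k = ∞`. -/
def domain (E : Type*) [NormedAddCommGroup E] (k : ℝ≥0∞) (A : ℝ≥0) : Set E :=
  {x | k = ∞ → (A : ℝ) * ‖x‖ < 1}

/-- The weight `(j/(ke))^(j/k)`, equal to `1` for `k = ∞`. -/
def weight (k : ℝ≥0∞) (j : ℕ) : ℝ :=
  if k = ∞ then 1 else ((j : ℝ) / (k.toReal * Real.exp 1)) ^ ((j : ℝ) / k.toReal)

/-- The `j`-th term `ρ^(-j) (j/(ke))^(j/k) ‖(1/j!) d̂ʲf(0)‖_Θ` of the norm with index `ρ`. -/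
def normTerm (Θ : HolomorphyType E) (k : ℝ≥0∞) (ρ : ℝ) (f : E → ℂ) (j : ℕ) : ℝ :=
  (ρ ^ j)⁻¹ * weight k j * Θ.norm j (taylor j f 0)

/-- Membership in `Exp^k_{Θ,0,A}(E)`. A function on the ball of radius `1/A` is represented by
its extension by zero. -/
structure MemExp (Θ : HolomorphyType E) (k : ℝ≥0∞) (A : ℝ≥0) (f : E → ℂ) : Prop where
  holomorphic : AnalyticOnNhd ℂ f (domain E k A)
  eq_zero : ∀ x ∉ domain E k A, f x = 0
  dhat_mem : ∀ j, dhat j f 0 ∈ Θ.poly j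
  growth_of_ne_top : k ≠ ∞ → ∀ ρ : ℝ, A < ρ → Summable (normTerm Θ k ρ f)
  growth_of_eq_top : k = ∞ →
    limsup (fun j : ℕ => ENNReal.ofReal (Θ.norm j (taylor j f 0)) ^ (1 / (j : ℝ))) atTop
      ≤ (A : ℝ≥0∞)

section Helpers

set_option linter.unusedSectionVars false

lemma isOpen_domain (k : ℝ≥0∞) (A : ℝ≥0) : IsOpen (domain E k A) := by
  by_cases hk : k = ∞
  · simp only [domain, hk, forall_const]
    exact isOpen_lt (by fun_prop) continuous_const
  · simp [domain, hk]

lemma zero_mem_domain (k : ℝ≥0∞) (A : ℝ≥0) : (0 : E) ∈ domain E k A := by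
  simp [domain]

lemma weight_nonneg (k : ℝ≥0∞) (j : ℕ) : 0 ≤ weight k j := by
  unfold weight; split_ifs <;> positivity

lemma dhat_add {f g : E → ℂ} {a : E} (hf : AnalyticAt ℂ f a) (hg : AnalyticAt ℂ g a) (n : ℕ) :
    dhat n (f + g) a = dhat n f a + dhat n g a := by
  funext x
  simp [dhat, iteratedFDeriv_add_apply hf.contDiffAt hg.contDiffAt]

lemma dhat_smul {f : E → ℂ} {a : E} (hf : AnalyticAt ℂ f a) (c : ℂ) (n : ℕ) :
    dhat n (c • f) a = c • dhat n f a := by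
  funext x
  simp [dhat, iteratedFDeriv_const_smul_apply hf.contDiffAt]

lemma dhat_zero (n : ℕ) (a : E) : dhat n (0 : E → ℂ) a = 0 := by
  have h := dhat_smul (f := (0 : E → ℂ)) (a := a) analyticAt_const 0 n
  simpa using h

lemma taylor_mem {Θ : HolomorphyType E} {n : ℕ} {f : E → ℂ} {a : E}
    (h : dhat n f a ∈ Θ.poly n) : taylor n f a ∈ Θ.poly n :=
  Submodule.smul_mem _ _ h

/-- Root test: the growth condition of infinite order, through series. -/
lemma limsup_le_iff_summable {c : ℕ → ℝ} (hc : ∀ j, 0 ≤ c j) (A : ℝ≥0) :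
    limsup (fun j : ℕ => ENNReal.ofReal (c j) ^ (1 / (j : ℝ))) atTop ≤ (A : ℝ≥0∞) ↔
      ∀ ρ : ℝ, A < ρ → Summable (fun j => (ρ ^ j)⁻¹ * c j) := by
  have key : ∀ (j : ℕ), j ≠ 0 → ∀ r : ℝ, 0 ≤ r →
      (ENNReal.ofReal (c j) ^ (1 / (j : ℝ)) ≤ ENNReal.ofReal r ↔ c j ≤ r ^ j) := by
    intro j hj r hr
    have hj' : (0 : ℝ) < j := by exact_mod_cast Nat.pos_of_ne_zero hj
    rw [one_div, ENNReal.rpow_inv_le_iff hj', ENNReal.rpow_natCast,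
      ← ENNReal.ofReal_pow hr, ENNReal.ofReal_le_ofReal_iff (by positivity)]
  constructor
  · intro h ρ hρ
    obtain ⟨r, hr1, hr2⟩ := exists_between hρ
    have hA : (0 : ℝ) ≤ A := A.2
    have hr0 : 0 < r := lt_of_le_of_lt hA hr1
    have hρ0 : 0 < ρ := hr0.trans hr2
    have hlt : limsup (fun j : ℕ => ENNReal.ofReal (c j) ^ (1 / (j : ℝ))) atTop
        < ENNReal.ofReal r := by
      refine lt_of_le_of_lt h ?_
      rw [← ENNReal.ofReal_coe_nnreal]
      exact (ENNReal.ofReal_lt_ofReal_iff hr0).2 hr1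
    have hev := eventually_lt_of_limsup_lt hlt
    have hgeo : Summable (fun j : ℕ => (r / ρ) ^ j) :=
      summable_geometric_of_lt_one (by positivity) ((div_lt_one hρ0).2 hr2)
    refine Summable.of_norm_bounded_eventually_nat hgeo ?_
    filter_upwards [hev, eventually_ne_atTop 0] with j hj hj0
    have h1 := (key j hj0 r hr0.le).1 hj.le
    rw [Real.norm_of_nonneg (mul_nonneg (by positivity) (hc j)), div_pow, div_eq_inv_mul]
    gcongr
  · intro h
    refine le_of_forall_gt_imp_ge_of_dense ?_
    intro b hb
    by_cases hbt : b = ∞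
    · simp [hbt]
    lift b to ℝ≥0 using hbt
    have hb' : (A : ℝ) < b := by exact_mod_cast hb
    have hb0 : (0 : ℝ) < b := lt_of_le_of_lt A.2 hb'
    have hs := (h b hb').tendsto_atTop_zero
    refine limsup_le_of_le (by isBoundedDefault) ?_
    filter_upwards [hs.eventually (gt_mem_nhds one_pos), eventually_ne_atTop 0] with j hj hj0
    rw [← ENNReal.ofReal_coe_nnreal]
    refine (key j hj0 b hb0.le).2 ?_
    have : (0 : ℝ) < (b : ℝ) ^ j := by positivity
    rw [inv_mul_lt_iff₀ this] at hj
    linarith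

variable {Θ : HolomorphyType E} {k : ℝ≥0∞} {A : ℝ≥0}

lemma growth_iff_summable {f : E → ℂ} (hf : ∀ j, dhat j f 0 ∈ Θ.poly j) :
    ((k ≠ ∞ → ∀ ρ : ℝ, A < ρ → Summable (normTerm Θ k ρ f)) ∧ (k = ∞ →
      limsup (fun j : ℕ => ENNReal.ofReal (Θ.norm j (taylor j f 0)) ^ (1 / (j : ℝ))) atTop
        ≤ (A : ℝ≥0∞))) ↔ ∀ ρ : ℝ, A < ρ → Summable (normTerm Θ k ρ f) := by
  by_cases hk : k = ∞
  · rw [limsup_le_iff_summable (fun j => Θ.norm_nonneg j _ (taylor_mem (hf j)))]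
    simp only [hk, ne_eq, not_true_eq_false, false_imp_iff, true_and, true_imp_iff]
    unfold normTerm
    simp [weight]
  · simp [hk]

lemma MemExp.analyticAt_zero {f : E → ℂ} (hf : MemExp Θ k A f) : AnalyticAt ℂ f 0 :=
  hf.holomorphic 0 (zero_mem_domain k A)

lemma MemExp.taylor_mem {f : E → ℂ} (hf : MemExp Θ k A f) (j : ℕ) : taylor j f 0 ∈ Θ.poly j :=
  HoloConv.taylor_mem (hf.dhat_mem j)

/-- The norms that define the topology are finite. -/
lemma MemExp.summable {f : E → ℂ} (hf : MemExp Θ k A f) {ρ : ℝ} (hρ : A < ρ) :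
    Summable (normTerm Θ k ρ f) :=
  (growth_iff_summable hf.dhat_mem).1 ⟨hf.growth_of_ne_top, hf.growth_of_eq_top⟩ ρ hρ

lemma MemExp.of_summable {f : E → ℂ} (h1 : AnalyticOnNhd ℂ f (domain E k A))
    (h2 : ∀ x ∉ domain E k A, f x = 0) (h3 : ∀ j, dhat j f 0 ∈ Θ.poly j)
    (h4 : ∀ ρ : ℝ, A < ρ → Summable (normTerm Θ k ρ f)) : MemExp Θ k A f :=
  ⟨h1, h2, h3, ((growth_iff_summable h3).2 h4).1, ((growth_iff_summable h3).2 h4).2⟩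

lemma MemExp.normTerm_nonneg {f : E → ℂ} (hf : MemExp Θ k A f) {ρ : ℝ} (hρ : A < ρ) (j : ℕ) :
    0 ≤ normTerm Θ k ρ f j := by
  have : (0 : ℝ) ≤ ρ := A.2.trans hρ.le
  exact mul_nonneg (mul_nonneg (by positivity) (weight_nonneg k j))
    (Θ.norm_nonneg j _ (hf.taylor_mem j))

lemma MemExp.normTerm_add_le {f g : E → ℂ} (hf : MemExp Θ k A f) (hg : MemExp Θ k A g)
    {ρ : ℝ} (hρ : A < ρ) (j : ℕ) :
    normTerm Θ k ρ (f + g) j ≤ normTerm Θ k ρ f j + normTerm Θ k ρ g j := by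
  have h0 : (0 : ℝ) ≤ ρ := A.2.trans hρ.le
  have h1 : taylor j (f + g) 0 = taylor j f 0 + taylor j g 0 := by
    simp [taylor, dhat_add hf.analyticAt_zero hg.analyticAt_zero]
  unfold normTerm
  rw [h1, ← mul_add]
  exact mul_le_mul_of_nonneg_left (Θ.norm_add_le j _ (hf.taylor_mem j) _ (hg.taylor_mem j))
    (mul_nonneg (by positivity) (weight_nonneg k j))

lemma MemExp.normTerm_smul {f : E → ℂ} (hf : MemExp Θ k A f) (c : ℂ) (ρ : ℝ) (j : ℕ) :
    normTerm Θ k ρ (c • f) j = ‖c‖ * normTerm Θ k ρ f j := by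
  have h1 : taylor j (c • f) 0 = c • taylor j f 0 := by
    rw [taylor, dhat_smul hf.analyticAt_zero, smul_comm]; rfl
  unfold normTerm
  rw [h1, Θ.norm_smul j c _ (hf.taylor_mem j)]
  ring

lemma MemExp.smul {f : E → ℂ} (hf : MemExp Θ k A f) (c : ℂ) : MemExp Θ k A (c • f) := by
  refine MemExp.of_summable (fun x hx => analyticAt_const.smul (hf.holomorphic x hx))
    (fun x hx => by simp [hf.eq_zero x hx]) (fun j => ?_) (fun ρ hρ => ?_)
  · rw [dhat_smul hf.analyticAt_zero]
    exact Submodule.smul_mem _ _ (hf.dhat_mem j)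
  · rw [show normTerm Θ k ρ (c • f) = fun j => ‖c‖ * normTerm Θ k ρ f j from
      funext (hf.normTerm_smul c ρ)]
    exact (hf.summable hρ).mul_left _

lemma MemExp.add {f g : E → ℂ} (hf : MemExp Θ k A f) (hg : MemExp Θ k A g) :
    MemExp Θ k A (f + g) := by
  have hd : ∀ j, dhat j (f + g) 0 ∈ Θ.poly j := fun j => by
    rw [dhat_add hf.analyticAt_zero hg.analyticAt_zero]
    exact Submodule.add_mem _ (hf.dhat_mem j) (hg.dhat_mem j)
  refine MemExp.of_summable (fun x hx => (hf.holomorphic x hx).add (hg.holomorphic x hx))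
    (fun x hx => by simp [hf.eq_zero x hx, hg.eq_zero x hx]) hd (fun ρ hρ => ?_)
  have h0 : (0 : ℝ) ≤ ρ := A.2.trans hρ.le
  refine Summable.of_nonneg_of_le (fun j => ?_) (fun j => hf.normTerm_add_le hg hρ j)
    ((hf.summable hρ).add (hg.summable hρ))
  exact mul_nonneg (mul_nonneg (by positivity) (weight_nonneg k j))
    (Θ.norm_nonneg j _ (HoloConv.taylor_mem (hd j)))

lemma MemExp.zero : MemExp Θ k A (0 : E → ℂ) := by
  refine MemExp.of_summable (fun x _ => analyticAt_const) (fun x _ => rfl)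
    (fun j => by rw [dhat_zero]; exact Submodule.zero_mem _) (fun ρ _ => ?_)
  have h : normTerm Θ k ρ (0 : E → ℂ) = fun _ => 0 := by
    funext j
    have := Θ.norm_smul j 0 0 (Submodule.zero_mem _)
    simp only [norm_zero, zero_mul, smul_zero] at this
    simp [normTerm, taylor, dhat_zero, this]
  rw [h]
  exact summable_zero

end Helpers

/-- `Exp^k_{Θ,0,A}(E)` as a vector space of functions. -/
def expSubmodule (Θ : HolomorphyType E) (k : ℝ≥0∞) (A : ℝ≥0) : Submodule ℂ (E → ℂ) where
  carrier := {f | MemExp Θ k A f}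
  zero_mem' := MemExp.zero
  add_mem' := fun hf hg => MemExp.add hf hg
  smul_mem' := fun c _ hf => MemExp.smul hf c

/-- The space `Exp^k_{Θ,0,A}(E)`; its topology is not the one of pointwise convergence. -/
def Exp (Θ : HolomorphyType E) (k : ℝ≥0∞) (A : ℝ≥0) : Type _ :=
  ↥(expSubmodule Θ k A)

namespace Exp

variable {Θ : HolomorphyType E} {k : ℝ≥0∞} {A : ℝ≥0}

instance : AddCommGroup (Exp Θ k A) := inferInstanceAs (AddCommGroup ↥(expSubmodule Θ k A))

instance : Module ℂ (Exp Θ k A) := inferInstanceAs (Module ℂ ↥(expSubmodule Θ k A))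

/-- The underlying function on `E` of an element of `Exp^k_{Θ,0,A}(E)`. -/
def toFun (f : Exp Θ k A) : E → ℂ := Subtype.val (p := fun g => g ∈ expSubmodule Θ k A) f

lemma memExp (f : Exp Θ k A) : MemExp Θ k A f.toFun :=
  Subtype.prop (p := fun g => g ∈ expSubmodule Θ k A) f

/-- The norm `‖f‖_{Θ,k,ρ} = ∑ⱼ ρ^(-j) (j/(ke))^(j/k) ‖(1/j!) d̂ʲf(0)‖_Θ` for `ρ > A`. -/
def seminorm (Θ : HolomorphyType E) (k : ℝ≥0∞) (A : ℝ≥0) (ρ : {ρ : ℝ // (A : ℝ) < ρ}) :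
    Seminorm ℂ (Exp Θ k A) :=
  Seminorm.of (fun f => ∑' j, normTerm Θ k ρ f.toFun j)
    (fun f g => by
      rw [← (f.memExp.summable ρ.2).tsum_add (g.memExp.summable ρ.2)]
      exact Summable.tsum_le_tsum (fun j => f.memExp.normTerm_add_le g.memExp ρ.2 j)
        ((f.memExp.add g.memExp).summable ρ.2)
        ((f.memExp.summable ρ.2).add (g.memExp.summable ρ.2)))
    (fun c f => by
      rw [← tsum_mul_left]
      exact tsum_congr (fun j => f.memExp.normTerm_smul c ρ j))

instance (A : ℝ≥0) : Nonempty {ρ : ℝ // (A : ℝ) < ρ} := ⟨⟨A + 1, by simp⟩⟩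

/-- The locally convex topology generated by the norms `‖·‖_{Θ,k,ρ}`, `ρ > A`. -/
instance : TopologicalSpace (Exp Θ k A) :=
  (SeminormFamily.moduleFilterBasis (𝕜 := ℂ) (seminorm Θ k A)).topology

lemma withSeminorms (Θ : HolomorphyType E) (k : ℝ≥0∞) (A : ℝ≥0) :
    WithSeminorms (seminorm Θ k A) := ⟨rfl⟩

end Exp

/-- A convolution operator: a continuous linear operator `L` with
`d(Lf)(·)a = L(df(·)a)` for all `a` and `f`. Here `g` is the function `df(·)a`, which lies in the
space again when the holomorphy type has canonical constants. -/
def IsConvolutionOperator {Θ : HolomorphyType E} {k : ℝ≥0∞} {A : ℝ≥0}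
    (L : Exp Θ k A →L[ℂ] Exp Θ k A) : Prop :=
  ∀ (a : E) (f g : Exp Θ k A), (∀ x ∈ domain E k A, g.toFun x = fderiv ℂ f.toFun x a) →
    ∀ x ∈ domain E k A, fderiv ℂ (L f).toFun x a = (L g).toFun x

/-- A mixing map. -/
def IsMixing {X : Type*} [TopologicalSpace X] (T : X → X) : Prop :=
  ∀ U V : Set X, IsOpen U → U.Nonempty → IsOpen V → V.Nonempty →
    ∃ n₀ : ℕ, ∀ n ≥ n₀, (T^[n] '' U ∩ V).Nonempty

/-- A hypercyclic map: some orbit `{x, T x, T² x, …}` is dense. -/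
def IsHypercyclic {X : Type*} [TopologicalSpace X] (T : X → X) : Prop :=
  ∃ x : X, Dense (Set.range fun n : ℕ => T^[n] x)

end HoloConv

end

/-!
# Convolution operators on spaces of entire functions of bounded type and order are mixing

The argument is the one of Godefroy and Shapiro. For `φ ∈ E'` the exponential `exp φ` belongs to
`Exp^k_{Θ,0,A}(E)`, because `k > 1` makes the weights `(j/(ke))^(j/k)` at most `(j!)^t` for some
`t < 1` (`summable_weight_mul_pow_div_factorial`). A convolution operator `L` commutes with
directional derivatives, so `u = L (exp φ)` solves `du = u φ` on a convex domain and is a multiple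
`B(φ) exp φ` of `exp φ` (`IsConvolutionOperator.apply_expDual`).

For each continuous functional `T` the transform `φ ↦ T (exp φ)` is continuous on `E'` and entire on
complex lines (`Exp.differentiable_expDual_line`, `Exp.continuous_expDual`), and it determines `T`,
because the powers `φ ^ j` can be recovered from it and span a dense subspace
(`Exp.eq_zero_of_expDual`). With the Hahn-Banach theorem and the identity theorem it follows that
the `exp φ` with `φ` in a nonempty open set span a dense subspace
(`Exp.dense_span_expDual_of_mem_nhds`). In particular `B` is not constant if `L` is not a multiple
of the identity, and by Liouville's theorem the open sets `{|B| < 1}` and `{|B| > 1}` are not empty.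
So the eigenvectors of `L` with eigenvalues of absolute value less than `1`, and those with
eigenvalues of absolute value greater than `1`, span dense subspaces. Therefore `L` is mixing
(`isMixing_of_dense_eigenvectors`).

Hypercyclicity follows from mixing by Birkhoff's transitivity theorem (`IsMixing.isHypercyclic`),
since the space is separable (`Exp.separableSpace`, where the separability of `E'` is used),
metrizable, and complete (`Exp.exists_tendsto_of_cauchy`). For completeness one has to see that a
sequence of homogeneous polynomials with summable norms is the Taylor series of a function that is
holomorphic on the whole domain, and not only near the origin. This is
`exists_hasFPowerSeriesOnBall_tsum`, which re-expands the series about each point by means of the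
canonical constants and the polarization inequality `norm_le_of_norm_diag_le`.
-/

namespace HoloConv

variable {E : Type*} [NormedAddCommGroup E] [NormedSpace ℂ E]

/-! ### Polarization -/

lemma sum_units_prod_mul_prod_comp {m : ℕ} (g : Fin m → Fin m) :
    ∑ ε : Fin m → ℤˣ, (∏ i, (((ε i : ℤˣ) : ℤ) : ℂ)) * ∏ j, (((ε (g j) : ℤˣ) : ℤ) : ℂ) =
      if Function.Bijective g then 2 ^ m else 0 := by
  classical
  split_ifs with hg
  · have h1 : ∀ ε : Fin m → ℤˣ,
        (∏ i, (((ε i : ℤˣ) : ℤ) : ℂ)) * ∏ j, (((ε (g j) : ℤˣ) : ℤ) : ℂ) = 1 := by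
      intro ε
      rw [Function.Bijective.prod_comp hg (fun i => (((ε i : ℤˣ) : ℤ) : ℂ)),
        ← Finset.prod_mul_distrib]
      refine Finset.prod_eq_one fun i _ => ?_
      rcases Int.units_eq_one_or (ε i) with h | h <;> simp [h]
    simp [h1]
  · have hs : ¬ Function.Surjective g := fun h => hg (Finite.injective_iff_bijective.1
      (Finite.injective_iff_surjective.2 h))
    obtain ⟨i₀, hi₀⟩ : ∃ i₀, ∀ j, g j ≠ i₀ := by
      simpa [Function.Surjective] using hs
    -- Flipping the sign at an index outside the range of `g` changes the sign of each term.
    let flip : (Fin m → ℤˣ) → (Fin m → ℤˣ) := fun ε => Function.update ε i₀ (-ε i₀)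
    have hflip : ∀ ε, flip (flip ε) = ε := fun ε => by simp [flip]
    let e : (Fin m → ℤˣ) ≃ (Fin m → ℤˣ) := ⟨flip, flip, hflip, hflip⟩
    have h2 : ∀ ε : Fin m → ℤˣ,
        (∏ i, (((flip ε i : ℤˣ) : ℤ) : ℂ)) * ∏ j, (((flip ε (g j) : ℤˣ) : ℤ) : ℂ) =
        -((∏ i, (((ε i : ℤˣ) : ℤ) : ℂ)) * ∏ j, (((ε (g j) : ℤˣ) : ℤ) : ℂ)) := by
      intro ε
      have h3 : ∀ j, flip ε (g j) = ε (g j) := fun j => by simp [flip, hi₀ j]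
      simp only [h3]
      rw [← Finset.mul_prod_erase _ _ (Finset.mem_univ i₀),
        ← Finset.mul_prod_erase Finset.univ (fun i => (((ε i : ℤˣ) : ℤ) : ℂ)) (Finset.mem_univ i₀)]
      have h4 : ∏ i ∈ Finset.univ.erase i₀, (((flip ε i : ℤˣ) : ℤ) : ℂ) =
          ∏ i ∈ Finset.univ.erase i₀, (((ε i : ℤˣ) : ℤ) : ℂ) :=
        Finset.prod_congr rfl fun i hi => by simp [flip, Finset.ne_of_mem_erase hi]
      rw [h4]
      simp [flip]
    have h5 := Equiv.sum_comp e (fun ε : Fin m → ℤˣ =>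
      (∏ i, (((ε i : ℤˣ) : ℤ) : ℂ)) * ∏ j, (((ε (g j) : ℤˣ) : ℤ) : ℂ))
    simp only [e, Equiv.coe_fn_mk, h2, Finset.sum_neg_distrib] at h5
    exact self_eq_neg.1 h5.symm

/-- The polarization identity. -/
lemma sum_units_map_diag {m : ℕ} (F : ContinuousMultilinearMap ℂ (fun _ : Fin m => E) ℂ)
    (hF : ∀ (σ : Equiv.Perm (Fin m)) x, F (x ∘ σ) = F x) (x : Fin m → E) :
    ∑ ε : Fin m → ℤˣ, (∏ i, (((ε i : ℤˣ) : ℤ) : ℂ)) *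
      F (fun _ => ∑ i, (((ε i : ℤˣ) : ℤ) : ℂ) • x i) = 2 ^ m * (m.factorial : ℂ) * F x := by
  classical
  have h1 : ∀ ε : Fin m → ℤˣ, F (fun _ => ∑ i, (((ε i : ℤˣ) : ℤ) : ℂ) • x i) =
      ∑ g : Fin m → Fin m, (∏ j, (((ε (g j) : ℤˣ) : ℤ) : ℂ)) * F (x ∘ g) := by
    intro ε
    rw [F.map_sum]
    refine Finset.sum_congr rfl fun g _ => ?_
    exact F.map_smul_univ (fun j => (((ε (g j) : ℤˣ) : ℤ) : ℂ)) (fun j => x (g j))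
  simp only [h1, Finset.mul_sum, ← mul_assoc]
  rw [Finset.sum_comm]
  simp only [← Finset.sum_mul, sum_units_prod_mul_prod_comp]
  have h2 : ∑ g : Fin m → Fin m, (if Function.Bijective g then (2 : ℂ) ^ m else 0) * F (x ∘ g) =
      ∑ g ∈ Finset.univ.filter (fun g : Fin m → Fin m => Function.Bijective g),
        (2 : ℂ) ^ m * F (x ∘ g) := by
    rw [Finset.sum_filter]
    exact Finset.sum_congr rfl fun g _ => by split_ifs <;> simp
  rw [h2, Finset.sum_congr rfl (g := fun _ => (2 : ℂ) ^ m * F x)]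
  · have h3 : (Finset.univ.filter (fun g : Fin m → Fin m => Function.Bijective g)).card =
        m.factorial := by
      rw [← Fintype.card_subtype,
        Fintype.card_congr (Equiv.ofBijective (fun σ : Equiv.Perm (Fin m) =>
          (⟨σ, σ.bijective⟩ : {g : Fin m → Fin m // Function.Bijective g}))
          ⟨fun σ τ h => Equiv.ext fun i => congrFun (congrArg Subtype.val h) i,
            fun g => ⟨Equiv.ofBijective g.1 g.2, rfl⟩⟩).symm, Fintype.card_perm, Fintype.card_fin]
    rw [Finset.sum_const, h3, nsmul_eq_mul]
    ring
  · intro g hg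
    have := hF (Equiv.ofBijective g (Finset.mem_filter.1 hg).2) x
    rw [Equiv.coe_ofBijective] at this
    rw [this]

/-- The norm of a symmetric multilinear form is at most `e ^ m` times the norm of its diagonal. -/
lemma norm_le_of_norm_diag_le {m : ℕ} (F : ContinuousMultilinearMap ℂ (fun _ : Fin m => E) ℂ)
    (hF : ∀ (σ : Equiv.Perm (Fin m)) x, F (x ∘ σ) = F x) {M : ℝ}
    (hM : ∀ x, ‖F fun _ => x‖ ≤ M * ‖x‖ ^ m) (hM0 : 0 ≤ M) : ‖F‖ ≤ Real.exp 1 ^ m * M := by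
  have hunit : ∀ x : Fin m → E, (∀ i, ‖x i‖ ≤ 1) → ‖F x‖ ≤ Real.exp 1 ^ m * M := by
    intro x hx
    have h1 := congrArg norm (sum_units_map_diag F hF x)
    have h2 : ‖∑ ε : Fin m → ℤˣ, (∏ i, (((ε i : ℤˣ) : ℤ) : ℂ)) *
        F (fun _ => ∑ i, (((ε i : ℤˣ) : ℤ) : ℂ) • x i)‖ ≤ 2 ^ m * (M * (m : ℝ) ^ m) := by
      refine (norm_sum_le _ _).trans ?_
      have h3 : ∀ ε ∈ (Finset.univ : Finset (Fin m → ℤˣ)), ‖(∏ i, (((ε i : ℤˣ) : ℤ) : ℂ)) *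
          F (fun _ => ∑ i, (((ε i : ℤˣ) : ℤ) : ℂ) • x i)‖ ≤ M * (m : ℝ) ^ m := by
        intro ε _
        have hε : ∀ i, ‖(((ε i : ℤˣ) : ℤ) : ℂ)‖ = 1 := fun i => by
          rcases Int.units_eq_one_or (ε i) with h | h <;> simp [h]
        rw [norm_mul, norm_prod]
        simp only [hε, Finset.prod_const_one, one_mul]
        refine (hM _).trans (mul_le_mul_of_nonneg_left ?_ hM0)
        refine pow_le_pow_left₀ (norm_nonneg _) ?_ _
        refine (norm_sum_le _ _).trans ?_
        calc ∑ i, ‖(((ε i : ℤˣ) : ℤ) : ℂ) • x i‖ ≤ ∑ _i : Fin m, (1 : ℝ) :=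
              Finset.sum_le_sum fun i _ => by rw [norm_smul, hε, one_mul]; exact hx i
          _ = m := by simp
      refine (Finset.sum_le_sum h3).trans ?_
      simp
    rw [h1, norm_mul, norm_mul, norm_pow] at h2
    simp only [Complex.norm_ofNat, Complex.norm_natCast, mul_assoc] at h2
    have h4 : (m.factorial : ℝ) * ‖F x‖ ≤ M * (m : ℝ) ^ m := le_of_mul_le_mul_left h2 (by positivity)
    have h5 : (m : ℝ) ^ m ≤ Real.exp 1 ^ m * m.factorial := by
      have := Real.pow_div_factorial_le_exp (m : ℝ) (by positivity) m
      rw [div_le_iff₀ (by positivity)] at this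
      rwa [← Real.exp_nat_mul, mul_one]
    have h6 : (m.factorial : ℝ) * ‖F x‖ ≤ m.factorial * (Real.exp 1 ^ m * M) :=
      h4.trans ((mul_le_mul_of_nonneg_left h5 hM0).trans (le_of_eq (by ring)))
    exact le_of_mul_le_mul_left h6 (by positivity)
  refine F.opNorm_le_bound (by positivity) fun x => ?_
  have h1 : x = fun i => ((‖x i‖ : ℝ) : ℂ) • (((‖x i‖ : ℝ) : ℂ)⁻¹ • x i) := by
    funext i
    by_cases hi : x i = 0
    · simp [hi]
    · rw [smul_smul, mul_inv_cancel₀ (by simpa using hi), one_smul]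
  rw [show F x = F (fun i => ((‖x i‖ : ℝ) : ℂ) • (((‖x i‖ : ℝ) : ℂ)⁻¹ • x i)) from
    congrArg F h1, F.map_smul_univ, norm_smul, norm_prod, mul_comm]
  simp only [Complex.norm_real, norm_norm]
  refine mul_le_mul_of_nonneg_right (hunit _ fun i => ?_) (by positivity)
  rw [norm_smul, norm_inv, Complex.norm_real, norm_norm]
  exact inv_mul_le_one

/-! ### Taylor expansion of homogeneous polynomials -/

lemma exists_hasFiniteFPowerSeriesOnBall_zero {j : ℕ} {P : E → ℂ} (hP : P ∈ homPoly E j) :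
    ∃ p : FormalMultilinearSeries ℂ E ℂ, HasFiniteFPowerSeriesOnBall P p 0 (j + 1) ⊤ ∧
      ∀ n h, (p n fun _ => h) = if n = j then P h else 0 := by
  obtain ⟨B, hB⟩ := hP
  let p : FormalMultilinearSeries ℂ E ℂ := fun n => if h : n = j then h ▸ B else 0
  have hp : ∀ n h, (p n fun _ => h) = if n = j then P h else 0 := by
    intro n h
    split_ifs with hn
    · subst hn
      simp [p, hB]
    · simp [p, hn]
  refine ⟨p, HasFiniteFPowerSeriesOnBall.mk' (fun m hm => ?_) (by simp) fun y _ => ?_, hp⟩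
  · have : m ≠ j := by omega
    simp [p, this]
  · simp [hp]

lemma exists_hasFiniteFPowerSeriesOnBall {j : ℕ} {P : E → ℂ} (hP : P ∈ homPoly E j) (a : E) :
    ∃ p : FormalMultilinearSeries ℂ E ℂ, HasFiniteFPowerSeriesOnBall P p a (j + 1) ⊤ := by
  obtain ⟨p, hp, -⟩ := exists_hasFiniteFPowerSeriesOnBall_zero hP
  have := hp.changeOrigin (y := a) (by simp)
  exact ⟨p.changeOrigin a, by simpa using this⟩

lemma hasSum_taylor {f : E → ℂ} {p : FormalMultilinearSeries ℂ E ℂ} {a : E} {r : ℝ≥0∞}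
    (hf : HasFPowerSeriesOnBall f p a r) {h : E} (hh : h ∈ Metric.eball 0 r) :
    HasSum (fun n => taylor n f a h) (f (a + h)) :=
  hf.hasSum_iteratedFDeriv hh

lemma taylor_eq_of_hasFPowerSeriesOnBall {f : E → ℂ} {p : FormalMultilinearSeries ℂ E ℂ} {a : E}
    {r : ℝ≥0∞} (hf : HasFPowerSeriesOnBall f p a r) (n : ℕ) (h : E) :
    taylor n f a h = p n fun _ => h := by
  have := hf.factorial_smul h n
  simp only [taylor, dhat, Pi.smul_apply, ← this, nsmul_eq_mul, smul_eq_mul]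
  rw [inv_mul_cancel_left₀ (Nat.cast_ne_zero.2 n.factorial_ne_zero)]

lemma hasSum_taylor_homPoly {j : ℕ} {P : E → ℂ} (hP : P ∈ homPoly E j) (a h : E) :
    HasSum (fun n => taylor n P a h) (P (a + h)) := by
  obtain ⟨p, hp⟩ := exists_hasFiniteFPowerSeriesOnBall hP a
  exact hasSum_taylor hp.toHasFPowerSeriesOnBall (by simp)

lemma taylor_homPoly_of_lt {j n : ℕ} (hn : j < n) {P : E → ℂ} (hP : P ∈ homPoly E j) (a : E) :
    taylor n P a = 0 := by
  obtain ⟨p, hp⟩ := exists_hasFiniteFPowerSeriesOnBall hP a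
  funext h
  rw [taylor_eq_of_hasFPowerSeriesOnBall hp.toHasFPowerSeriesOnBall, hp.finite n hn]
  rfl

lemma contDiff_of_mem_homPoly {j : ℕ} {P : E → ℂ} (hP : P ∈ homPoly E j) : ContDiff ℂ ω P := by
  rw [contDiff_iff_contDiffAt]
  intro a
  obtain ⟨p, hp⟩ := exists_hasFiniteFPowerSeriesOnBall hP a
  exact hp.toHasFPowerSeriesOnBall.analyticAt.contDiffAt

lemma taylor_homPoly_zero {j : ℕ} {P : E → ℂ} (hP : P ∈ homPoly E j) (n : ℕ) :
    taylor n P 0 = if n = j then P else 0 := by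
  obtain ⟨p, hp, hpn⟩ := exists_hasFiniteFPowerSeriesOnBall_zero hP
  funext h
  rw [taylor_eq_of_hasFPowerSeriesOnBall hp.toHasFPowerSeriesOnBall, hpn]
  split_ifs <;> rfl

lemma taylor_zero_apply (f : E → ℂ) (a h : E) : taylor 0 f a h = f a := by
  simp [taylor, dhat]

/-! ### Sums of homogeneous polynomials -/

namespace HolomorphyType

variable {Θ : HolomorphyType E}

/-- With canonical constants the norm of a holomorphy type dominates the supremum norm. -/
lemma HasCanonicalConstants.norm_apply_le (hcan : Θ.HasCanonicalConstants) {j : ℕ} {P : E → ℂ}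
    (hP : P ∈ Θ.poly j) (x : E) : ‖P x‖ ≤ Θ.norm j P * ‖x‖ ^ j := by
  have h := hcan 0 j (Nat.zero_le j) x P hP
  have h1 : taylor 0 P x = fun _ => P x := funext fun h => taylor_zero_apply P x h
  rw [h1, Θ.norm_const] at h
  simpa using h

lemma taylor_mem_poly {j m : ℕ} (hm : m ≤ j) {P : E → ℂ} (hP : P ∈ Θ.poly j) (a : E) :
    taylor m P a ∈ Θ.poly m :=
  HoloConv.taylor_mem (Θ.dhat_mem m j hm a P hP)

lemma norm_zero_eq (Θ : HolomorphyType E) (j : ℕ) : Θ.norm j 0 = 0 := by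
  have := Θ.norm_smul j 0 0 (Submodule.zero_mem _)
  simpa using this

lemma HasCanonicalConstants.norm_taylor_apply_le (hcan : Θ.HasCanonicalConstants) {j : ℕ}
    {P : E → ℂ} (hP : P ∈ Θ.poly j) (m : ℕ) (a h : E) :
    ‖taylor m P a h‖ ≤ (j.choose m : ℝ) * Θ.norm j P * ‖a‖ ^ (j - m) * ‖h‖ ^ m := by
  by_cases hm : m ≤ j
  · refine (hcan.norm_apply_le (taylor_mem_poly hm hP a) h).trans ?_
    gcongr
    exact hcan m j hm a P hP
  · rw [taylor_homPoly_of_lt (not_le.1 hm) (Θ.poly_le j hP), Nat.choose_eq_zero_of_lt (not_le.1 hm)]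
    simp

end HolomorphyType

lemma choose_mul_pow_le {j m : ℕ} {s t R : ℝ} (hs : 0 ≤ s) (ht : 0 ≤ t) (hR : s + t = R) :
    (j.choose m : ℝ) * s ^ (j - m) * t ^ m ≤ R ^ j := by
  by_cases hm : m ≤ j
  · rw [← hR, add_comm s t, add_pow]
    have := Finset.single_le_sum (f := fun i => t ^ i * s ^ (j - i) * (j.choose i : ℝ))
      (s := Finset.range (j + 1)) (fun i _ => by positivity) (Finset.mem_range_succ_iff.2 hm)
    refine le_trans (le_of_eq ?_) this
    ring
  · rw [Nat.choose_eq_zero_of_lt (not_le.1 hm)]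
    have : 0 ≤ R := by linarith
    simp only [Nat.cast_zero, zero_mul]
    positivity

section Sum

variable {Θ : HolomorphyType E} (hcan : Θ.HasCanonicalConstants) {P : ℕ → E → ℂ}
  (hP : ∀ j, P j ∈ Θ.poly j) {R : ℝ} (hR : Summable fun j => Θ.norm j (P j) * R ^ j)

include hcan hP hR

/-- A series of homogeneous polynomials that converges on the ball of radius `R` can be expanded
about each point `a` of this ball. The `m`-th coefficient is the sum over `j` of the `m`-th
derivatives of the `j`-th terms at `a`. These are estimated by means of the canonical constants and
polarization, and so the radius of convergence at `a` is at least `(R - ‖a‖) / e`. -/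
theorem exists_hasFPowerSeriesOnBall_tsum {a : E} (ha : ‖a‖ < R) :
    ∃ (p : FormalMultilinearSeries ℂ E ℂ) (r : ℝ≥0∞),
      HasFPowerSeriesOnBall (fun x => ∑' j, P j x) p a r ∧
      ∀ m h, (p m fun _ => h) = ∑' j, taylor m (P j) a h := by
  set δ : ℝ := R - ‖a‖ with hδ
  have hδ0 : 0 < δ := sub_pos.2 ha
  have hR0 : 0 < R := (norm_nonneg a).trans_lt ha
  have he : 0 < Real.exp 1 := Real.exp_pos 1
  have hPn : ∀ j, 0 ≤ Θ.norm j (P j) := fun j => Θ.norm_nonneg j _ (hP j)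
  have hterm : ∀ j m, ∀ h : E, ‖taylor m (P j) a h‖ ≤
      Θ.norm j (P j) * R ^ j * (‖h‖ / δ) ^ m := by
    intro j m h
    refine (hcan.norm_taylor_apply_le (hP j) m a h).trans ?_
    have h1 := choose_mul_pow_le (j := j) (m := m) (norm_nonneg a) hδ0.le
      (by rw [hδ]; ring : ‖a‖ + δ = R)
    rw [div_pow, mul_div_assoc', le_div_iff₀ (by positivity)]
    calc (j.choose m : ℝ) * Θ.norm j (P j) * ‖a‖ ^ (j - m) * ‖h‖ ^ m * δ ^ m
        = Θ.norm j (P j) * ((j.choose m : ℝ) * ‖a‖ ^ (j - m) * δ ^ m) * ‖h‖ ^ m := by ring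
      _ ≤ Θ.norm j (P j) * R ^ j * ‖h‖ ^ m := by
          gcongr
          exact hPn j
  let F : ∀ m j : ℕ, ContinuousMultilinearMap ℂ (fun _ : Fin m => E) ℂ :=
    fun m j => (m.factorial : ℂ)⁻¹ • iteratedFDeriv ℂ m (P j) a
  have hFdiag : ∀ m j h, (F m j fun _ => h) = taylor m (P j) a h := fun m j h => rfl
  have hFnorm : ∀ m j, ‖F m j‖ ≤ (Real.exp 1 / δ) ^ m * (Θ.norm j (P j) * R ^ j) := by
    intro m j
    have h1 : ‖F m j‖ ≤ Real.exp 1 ^ m * (Θ.norm j (P j) * R ^ j / δ ^ m) := by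
      refine norm_le_of_norm_diag_le _ (fun σ x => ?_) (fun h => ?_) ?_
      · have := (contDiff_of_mem_homPoly (Θ.poly_le j (hP j))).contDiffAt (x := a)
          |>.iteratedFDeriv_comp_perm x σ
        simp [F, this]
      · rw [hFdiag]
        refine (hterm j m h).trans (le_of_eq ?_)
        rw [div_pow]
        ring
      · have := hPn j
        positivity
    refine h1.trans (le_of_eq ?_)
    rw [div_pow]
    ring
  have hFsum : ∀ m, Summable (F m) := fun m =>
    Summable.of_norm_bounded (hR.mul_left _) (hFnorm m)
  let p : FormalMultilinearSeries ℂ E ℂ := fun m => ∑' j, F m j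
  have hp : ∀ m h, HasSum (fun j => taylor m (P j) a h) (p m fun _ => h) := fun m h =>
    (ContinuousMultilinearMap.hasSum_eval (hFsum m).hasSum fun _ => h)
  have hpnorm : ∀ m, ‖p m‖ ≤ (Real.exp 1 / δ) ^ m * ∑' j, Θ.norm j (P j) * R ^ j := by
    intro m
    rw [← tsum_mul_left]
    exact tsum_of_norm_bounded (hR.mul_left _).hasSum (hFnorm m)
  have hr0 : 0 < δ / Real.exp 1 := by positivity
  refine ⟨p, ENNReal.ofReal (δ / Real.exp 1), ⟨?_, by simpa using hr0, fun {h} hh => ?_⟩,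
    fun m h => (hp m h).tsum_eq.symm⟩
  · refine p.le_radius_of_bound (∑' j, Θ.norm j (P j) * R ^ j) fun m => ?_
    rw [Real.coe_toNNReal _ hr0.le]
    calc ‖p m‖ * (δ / Real.exp 1) ^ m
        ≤ (Real.exp 1 / δ) ^ m * (∑' j, Θ.norm j (P j) * R ^ j) * (δ / Real.exp 1) ^ m := by
          gcongr
          exact hpnorm m
      _ = (Real.exp 1 / δ * (δ / Real.exp 1)) ^ m * ∑' j, Θ.norm j (P j) * R ^ j := by
          rw [mul_pow]; ring
      _ = _ := by rw [div_mul_div_cancel₀ hδ0.ne', div_self he.ne', one_pow, one_mul]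
  · have hhδ : ‖h‖ < δ := by
      have h1 : ‖h‖ < δ / Real.exp 1 := by
        rw [Metric.mem_eball, edist_zero_right, ← ofReal_norm,
          ENNReal.ofReal_lt_ofReal_iff hr0] at hh
        exact hh
      refine h1.trans_le (div_le_self hδ0.le ?_)
      have := Real.add_one_le_exp 1
      linarith
    have hgeo : Summable fun m : ℕ => (‖h‖ / δ) ^ m :=
      summable_geometric_of_lt_one (by positivity) ((div_lt_one hδ0).2 hhδ)
    have hprod : Summable fun q : ℕ × ℕ => taylor q.2 (P q.1) a h := by
      refine Summable.of_norm_bounded (hR.mul_of_nonneg hgeo (fun j => ?_) fun m => ?_)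
        (fun q => hterm q.1 q.2 h)
      · have := hPn j
        simp only [Pi.zero_apply]
        positivity
      · simp only [Pi.zero_apply]
        positivity
    have hprod' : Summable fun q : ℕ × ℕ => taylor q.1 (P q.2) a h := hprod.prod_symm
    have h1 := hprod'.hasSum.prod_fiberwise fun m => hp m h
    have h2 := hprod.hasSum.prod_fiberwise fun j => hasSum_taylor_homPoly (Θ.poly_le j (hP j)) a h
    have h3 : ∑' q : ℕ × ℕ, taylor q.1 (P q.2) a h = ∑' q : ℕ × ℕ, taylor q.2 (P q.1) a h :=
      (Equiv.prodComm ℕ ℕ).tsum_eq (fun q : ℕ × ℕ => taylor q.2 (P q.1) a h)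
    rw [h3, ← h2.tsum_eq] at h1
    exact h1

lemma analyticAt_tsum {a : E} (ha : ‖a‖ < R) : AnalyticAt ℂ (fun x => ∑' j, P j x) a := by
  obtain ⟨p, r, hp, -⟩ := exists_hasFPowerSeriesOnBall_tsum hcan hP hR ha
  exact hp.analyticAt

lemma taylor_tsum_zero (hR0 : 0 < R) (m : ℕ) : taylor m (fun x => ∑' j, P j x) 0 = P m := by
  obtain ⟨p, r, hp, hpm⟩ := exists_hasFPowerSeriesOnBall_tsum hcan hP hR (a := 0) (by simpa)
  funext h
  rw [taylor_eq_of_hasFPowerSeriesOnBall hp, hpm, tsum_eq_single m]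
  · simp [taylor_homPoly_zero (Θ.poly_le m (hP m))]
  · intro j hj
    simp [taylor_homPoly_zero (Θ.poly_le j (hP j)), hj.symm]

end Sum

/-! ### Functions with prescribed Taylor coefficients -/

section Weight

lemma weight_pos {k : ℝ≥0∞} (hk : k ≠ 0) (j : ℕ) : 0 < weight k j := by
  unfold weight
  split_ifs with h
  · exact one_pos
  · have hk' : 0 < k.toReal := ENNReal.toReal_pos hk h
    rcases Nat.eq_zero_or_pos j with rfl | hj
    · simp
    · have : (0 : ℝ) < j := by exact_mod_cast hj
      positivity

/-- For finite `k` the weights grow faster than any geometric sequence. -/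
lemma eventually_pow_le_weight {k : ℝ≥0∞} (hk : k ≠ 0) (hk' : k ≠ ∞) (M : ℝ) (hM : 0 ≤ M) :
    ∀ᶠ j : ℕ in atTop, M ^ j ≤ weight k j := by
  have hκ : 0 < k.toReal := ENNReal.toReal_pos hk hk'
  have h1 : Tendsto (fun j : ℕ => ((j : ℝ) / (k.toReal * Real.exp 1)) ^ (1 / k.toReal))
      atTop atTop :=
    (tendsto_rpow_atTop (by positivity)).comp
      (tendsto_natCast_atTop_atTop.atTop_div_const (by positivity))
  filter_upwards [h1.eventually_ge_atTop M] with j hj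
  rw [weight, if_neg hk', show (j : ℝ) / k.toReal = 1 / k.toReal * (j : ℝ) by ring,
    Real.rpow_mul (by positivity), Real.rpow_natCast]
  exact pow_le_pow_left₀ hM hj j

end Weight

lemma convex_domain (k : ℝ≥0∞) (A : ℝ≥0) : Convex ℝ (domain E k A) := by
  by_cases hk : k = ∞
  · simp only [domain, hk, forall_const]
    have h := ((convexOn_univ_norm (E := E)).smul A.2).convex_lt 1
    simpa using h
  · simpa [domain, hk] using convex_univ

/-- The sequences `(Pⱼ)` that are the Taylor coefficients at `0` of the elements of
`Exp^k_{Θ,0,A}(E)`. -/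
structure IsCoeff (Θ : HolomorphyType E) (k : ℝ≥0∞) (A : ℝ≥0) (P : ℕ → E → ℂ) : Prop where
  mem : ∀ j, P j ∈ Θ.poly j
  summable : ∀ ρ : ℝ, A < ρ → Summable fun j => (ρ ^ j)⁻¹ * weight k j * Θ.norm j (P j)

variable {Θ : HolomorphyType E} {k : ℝ≥0∞} {A : ℝ≥0}

lemma IsCoeff.exists_radius {P : ℕ → E → ℂ} (hP : IsCoeff Θ k A P) (hk : k ≠ 0) {x : E}
    (hx : x ∈ domain E k A) : ∃ R : ℝ, ‖x‖ < R ∧ Summable fun j => Θ.norm j (P j) * R ^ j := by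
  by_cases hk' : k = ∞
  · have hx' : (A : ℝ) * ‖x‖ < 1 := hx hk'
    have h1 : ∀ᶠ ρ in 𝓝[>] (A : ℝ), ρ * ‖x‖ < 1 :=
      nhdsWithin_le_nhds ((continuous_mul_const ‖x‖).tendsto (A : ℝ) |>.eventually_lt_const hx')
    obtain ⟨ρ, hρ, hAρ⟩ := (h1.and self_mem_nhdsWithin).exists
    have hAρ' : (A : ℝ) < ρ := hAρ
    have hρ0 : 0 < ρ := A.2.trans_lt hAρ'
    refine ⟨1 / ρ, by rwa [lt_div_iff₀ hρ0, mul_comm], (hP.summable ρ hAρ').congr fun j => ?_⟩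
    simp only [weight, hk', if_true, one_div, inv_pow]
    ring
  · refine ⟨‖x‖ + 1, by linarith, ?_⟩
    have hA : (A : ℝ) < A + 1 := by linarith
    refine Summable.of_norm_bounded_eventually_nat (hP.summable _ hA) ?_
    filter_upwards [eventually_pow_le_weight hk hk' ((A + 1) * (‖x‖ + 1)) (by positivity)] with j hj
    have h0 := Θ.norm_nonneg j _ (hP.mem j)
    rw [Real.norm_of_nonneg (by positivity), mul_comm]
    refine mul_le_mul_of_nonneg_right ?_ h0
    rw [le_inv_mul_iff₀ (by positivity), ← mul_pow]
    exact hj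

/-- The function with the Taylor coefficients `Pⱼ` at the origin, extended by zero. -/
noncomputable def sumFun (k : ℝ≥0∞) (A : ℝ≥0) (P : ℕ → E → ℂ) : E → ℂ :=
  (domain E k A).indicator fun x => ∑' j, P j x

lemma sumFun_eventuallyEq (P : ℕ → E → ℂ) {x : E} (hx : x ∈ domain E k A) :
    sumFun k A P =ᶠ[𝓝 x] fun x => ∑' j, P j x := by
  filter_upwards [(isOpen_domain k A).mem_nhds hx] with y hy
  exact Set.indicator_of_mem hy _

lemma dhat_congr {f g : E → ℂ} {a : E} (h : f =ᶠ[𝓝 a] g) (n : ℕ) : dhat n f a = dhat n g a := by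
  funext x
  simp only [dhat, (h.iteratedFDeriv ℂ n).eq_of_nhds]

lemma taylor_congr {f g : E → ℂ} {a : E} (h : f =ᶠ[𝓝 a] g) (n : ℕ) :
    taylor n f a = taylor n g a := by
  rw [taylor, taylor, dhat_congr h]

lemma dhat_eq_smul_taylor (n : ℕ) (f : E → ℂ) (a : E) :
    dhat n f a = (n.factorial : ℂ) • taylor n f a := by
  rw [taylor, smul_smul, mul_inv_cancel₀ (Nat.cast_ne_zero.2 n.factorial_ne_zero), one_smul]

lemma IsCoeff.taylor_sumFun {P : ℕ → E → ℂ} (hP : IsCoeff Θ k A P)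
    (hcan : Θ.HasCanonicalConstants) (hk : k ≠ 0) (j : ℕ) : taylor j (sumFun k A P) 0 = P j := by
  obtain ⟨R, hR0, hR⟩ := hP.exists_radius hk (zero_mem_domain k A)
  rw [taylor_congr (sumFun_eventuallyEq P (zero_mem_domain k A))]
  exact taylor_tsum_zero hcan hP.mem hR (by simpa using hR0) j

lemma IsCoeff.memExp_sumFun {P : ℕ → E → ℂ} (hP : IsCoeff Θ k A P)
    (hcan : Θ.HasCanonicalConstants) (hk : k ≠ 0) : MemExp Θ k A (sumFun k A P) := by
  refine MemExp.of_summable (fun x hx => ?_) (fun x hx => Set.indicator_of_notMem hx _)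
    (fun j => ?_) (fun ρ hρ => ?_)
  · obtain ⟨R, hR0, hR⟩ := hP.exists_radius hk hx
    exact (analyticAt_tsum hcan hP.mem hR hR0).congr (sumFun_eventuallyEq P hx).symm
  · rw [dhat_eq_smul_taylor, hP.taylor_sumFun hcan hk]
    exact Submodule.smul_mem _ _ (hP.mem j)
  · unfold normTerm
    simpa only [hP.taylor_sumFun hcan hk] using hP.summable ρ hρ

namespace Exp

/-- The element of `Exp^k_{Θ,0,A}(E)` with given Taylor coefficients. -/
noncomputable def ofCoeff (hcan : Θ.HasCanonicalConstants) (hk : k ≠ 0) {P : ℕ → E → ℂ}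
    (hP : IsCoeff Θ k A P) : Exp Θ k A :=
  (⟨sumFun k A P, hP.memExp_sumFun hcan hk⟩ : expSubmodule Θ k A)

/-- The `j`-th Taylor coefficient at the origin. -/
noncomputable def coeff (j : ℕ) : Exp Θ k A →ₗ[ℂ] (E → ℂ) where
  toFun f := taylor j f.toFun 0
  map_add' f g := by
    change taylor j (f.toFun + g.toFun) 0 = _
    rw [taylor, dhat_add f.memExp.analyticAt_zero g.memExp.analyticAt_zero, smul_add]
    rfl
  map_smul' c f := by
    change taylor j (c • f.toFun) 0 = _
    rw [taylor, dhat_smul f.memExp.analyticAt_zero, smul_comm]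
    rfl

lemma coeff_mem (j : ℕ) (f : Exp Θ k A) : coeff j f ∈ Θ.poly j :=
  f.memExp.taylor_mem j

lemma isCoeff_coeff (f : Exp Θ k A) : IsCoeff Θ k A fun j => coeff j f :=
  ⟨fun j => coeff_mem j f, fun _ hρ => f.memExp.summable hρ⟩

@[simp]
lemma coeff_ofCoeff (hcan : Θ.HasCanonicalConstants) (hk : k ≠ 0) {P : ℕ → E → ℂ}
    (hP : IsCoeff Θ k A P) (j : ℕ) : coeff j (ofCoeff hcan hk hP) = P j :=
  hP.taylor_sumFun hcan hk j

lemma toFun_ofCoeff (hcan : Θ.HasCanonicalConstants) (hk : k ≠ 0) {P : ℕ → E → ℂ}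
    (hP : IsCoeff Θ k A P) {x : E} (hx : x ∈ domain E k A) :
    (ofCoeff hcan hk hP).toFun x = ∑' j, P j x :=
  Set.indicator_of_mem hx fun x => ∑' j, P j x

lemma coeff_zero_apply (f : Exp Θ k A) (x : E) : coeff 0 f x = f.toFun 0 :=
  taylor_zero_apply _ _ _

/-- By the identity theorem, two elements that agree on the domain are equal. -/
lemma ext_of_eqOn {f g : Exp Θ k A} (h : Set.EqOn f.toFun g.toFun (domain E k A)) : f = g := by
  refine Subtype.ext (funext fun x => ?_)
  by_cases hx : x ∈ domain E k A
  · exact h hx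
  · exact (f.memExp.eq_zero x hx).trans (g.memExp.eq_zero x hx).symm

/-- By the identity theorem, an element is determined by its Taylor coefficients. -/
lemma ext_coeff {f g : Exp Θ k A} (h : ∀ j, coeff j f = coeff j g) : f = g := by
  refine ext_of_eqOn (f.memExp.holomorphic.eqOn_of_preconnected_of_eventuallyEq g.memExp.holomorphic
    (convex_domain k A).isPreconnected (zero_mem_domain k A) ?_)
  obtain ⟨p, r, hp⟩ := f.memExp.analyticAt_zero
  obtain ⟨q, s, hq⟩ := g.memExp.analyticAt_zero
  filter_upwards [Metric.eball_mem_nhds (0 : E) hp.r_pos, Metric.eball_mem_nhds (0 : E) hq.r_pos]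
    with y hy hy'
  have h1 := hasSum_taylor hp hy
  have h2 := hasSum_taylor hq hy'
  rw [zero_add] at h1 h2
  refine h1.unique (h2.congr_fun fun j => ?_)
  exact congrFun (h j) y

/-! ### The topology of the space -/

lemma seminorm_apply (ρ : {ρ : ℝ // (A : ℝ) < ρ}) (f : Exp Θ k A) :
    seminorm Θ k A ρ f = ∑' j, ((ρ : ℝ) ^ j)⁻¹ * weight k j * Θ.norm j (coeff j f) := rfl

lemma term_nonneg (ρ : {ρ : ℝ // (A : ℝ) < ρ}) {j : ℕ} {P : E → ℂ} (hP : P ∈ Θ.poly j) :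
    0 ≤ ((ρ : ℝ) ^ j)⁻¹ * weight k j * Θ.norm j P := by
  have h0 : (0 : ℝ) ≤ ρ := A.2.trans ρ.2.le
  have h1 := weight_nonneg k j
  have h2 := Θ.norm_nonneg j P hP
  positivity

lemma term_le_seminorm (ρ : {ρ : ℝ // (A : ℝ) < ρ}) (f : Exp Θ k A) (j : ℕ) :
    ((ρ : ℝ) ^ j)⁻¹ * weight k j * Θ.norm j (coeff j f) ≤ seminorm Θ k A ρ f :=
  (f.isCoeff_coeff.summable ρ ρ.2).le_tsum j fun i _ => term_nonneg ρ (coeff_mem i f)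

lemma seminorm_anti {ρ ρ' : {ρ : ℝ // (A : ℝ) < ρ}} (h : ρ ≤ ρ') :
    seminorm Θ k A ρ' ≤ seminorm Θ k A ρ := by
  intro f
  refine Summable.tsum_le_tsum (fun j => ?_) (f.memExp.summable ρ'.2) (f.memExp.summable ρ.2)
  have h0 : (0 : ℝ) < ρ := A.2.trans_lt ρ.2
  have h1 := weight_nonneg k j
  have h2 := Θ.norm_nonneg j _ (f.memExp.taylor_mem j)
  have h3 : (ρ : ℝ) ≤ ρ' := h
  unfold normTerm
  gcongr

lemma finset_sup_seminorm_le (s : Finset {ρ : ℝ // (A : ℝ) < ρ}) :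
    ∃ ρ, s.sup (seminorm Θ k A) ≤ seminorm Θ k A ρ := by
  rcases s.eq_empty_or_nonempty with rfl | hs
  · exact ⟨Classical.arbitrary _, by simp [bot_le]⟩
  · exact ⟨s.min' hs, Finset.sup_le fun ρ hρ => seminorm_anti (s.min'_le ρ hρ)⟩

instance : IsTopologicalAddGroup (Exp Θ k A) := (withSeminorms Θ k A).topologicalAddGroup

instance : ContinuousSMul ℂ (Exp Θ k A) := (withSeminorms Θ k A).continuousSMul

instance : LocallyConvexSpace ℝ (Exp Θ k A) := (withSeminorms Θ k A).toLocallyConvexSpace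

instance : FirstCountableTopology (Exp Θ k A) := by
  let r : ℕ → {ρ : ℝ // (A : ℝ) < ρ} := fun n => ⟨A + 1 / ((n : ℝ) + 1), by
    have : (0 : ℝ) < 1 / ((n : ℝ) + 1) := by positivity
    linarith⟩
  have hr : WithSeminorms (fun n : ℕ => seminorm Θ k A (r n)) := by
    refine (withSeminorms Θ k A).congr (fun n => ?_) (fun ρ => ?_)
    · exact ⟨{r n}, 1, by simp [Seminorm.comp_id]⟩
    · obtain ⟨n, hn⟩ := exists_nat_one_div_lt (sub_pos.2 ρ.2)
      refine ⟨{n}, 1, ?_⟩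
      have h1 : r n ≤ ρ := by
        change (A : ℝ) + 1 / ((n : ℝ) + 1) ≤ ρ
        linarith
      simpa [Seminorm.comp_id] using seminorm_anti h1
  exact hr.firstCountableTopology

/-- A continuous functional is bounded by one of the norms. -/
lemma exists_norm_le (T : Exp Θ k A →L[ℂ] ℂ) :
    ∃ (ρ : {ρ : ℝ // (A : ℝ) < ρ}) (C : ℝ), 0 ≤ C ∧ ∀ f, ‖T f‖ ≤ C * seminorm Θ k A ρ f := by
  obtain ⟨s, C, -, hC⟩ := Seminorm.bound_of_continuous (withSeminorms Θ k A)
    ((normSeminorm ℂ ℂ).comp (T : Exp Θ k A →ₗ[ℂ] ℂ))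
    (continuous_norm.comp T.continuous)
  obtain ⟨ρ, hρ⟩ := finset_sup_seminorm_le (Θ := Θ) (k := k) s
  exact ⟨ρ, C, C.2, fun f => (hC f).trans (mul_le_mul_of_nonneg_left (hρ f) C.2)⟩

lemma t2Space (hk : k ≠ 0) : T2Space (Exp Θ k A) := by
  have : T1Space (Exp Θ k A) := by
    refine (withSeminorms Θ k A).T1_of_separating fun f hf => ?_
    by_contra! h
    refine hf (ext_coeff fun j => ?_)
    rw [map_zero]
    refine Θ.eq_zero_of_norm j _ (coeff_mem j f) (le_antisymm ?_ (Θ.norm_nonneg j _ (coeff_mem j f)))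
    let ρ : {ρ : ℝ // (A : ℝ) < ρ} := ⟨A + 1, by linarith⟩
    have h1 := term_le_seminorm ρ f j
    rw [h ρ] at h1
    have h2 := weight_pos hk j
    have h3 : (0 : ℝ) < ρ := A.2.trans_lt ρ.2
    exact nonpos_of_mul_nonpos_right h1 (by positivity)
  infer_instance

/-- Evaluation at the origin. -/
noncomputable def evalZero : Exp Θ k A →L[ℂ] ℂ where
  toFun f := f.toFun 0
  map_add' _ _ := rfl
  map_smul' _ _ := rfl
  cont := by
    let T : Exp Θ k A →ₗ[ℂ] ℂ := ⟨⟨fun f => f.toFun 0, fun _ _ => rfl⟩, fun _ _ => rfl⟩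
    let ρ : {ρ : ℝ // (A : ℝ) < ρ} := ⟨A + 1, by linarith⟩
    refine (withSeminorms Θ k A).continuous_normedSpace_rng ℂ T ⟨{ρ}, 1, fun f => ?_⟩
    have h1 := term_le_seminorm ρ f 0
    have h2 : coeff 0 f = fun _ => f.toFun 0 := funext (coeff_zero_apply f)
    have h3 : weight k 0 = 1 := by simp [weight]
    rw [h2, Θ.norm_const, h3] at h1
    have h4 : ‖f.toFun 0‖ ≤ seminorm Θ k A ρ f := by simpa using h1
    simp only [Finset.sup_singleton, one_smul]
    exact h4

end Exp

namespace Exp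

/-! ### Completeness -/

/-- Cauchy sequences converge: their Taylor coefficients converge in the spaces of homogeneous
polynomials, and the limits are the Taylor coefficients of the limit. -/
lemma exists_tendsto_of_cauchy (hcan : Θ.HasCanonicalConstants) (hk : k ≠ 0) {u : ℕ → Exp Θ k A}
    (hu : ∀ (ρ : {ρ : ℝ // (A : ℝ) < ρ}), ∀ ε > 0, ∃ N, ∀ m ≥ N, ∀ n ≥ N,
      seminorm Θ k A ρ (u m - u n) < ε) : ∃ f, Tendsto u atTop (𝓝 f) := by
  have hcj : ∀ j, ∃ P ∈ Θ.poly j, Tendsto (fun n => Θ.norm j (coeff j (u n) - P)) atTop (𝓝 0) := by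
    intro j
    refine Θ.complete j (fun n => coeff j (u n)) (fun n => coeff_mem j _) fun ε hε => ?_
    let ρ : {ρ : ℝ // (A : ℝ) < ρ} := ⟨A + 1, by linarith⟩
    have hw : 0 < ((ρ : ℝ) ^ j)⁻¹ * weight k j := by
      have h2 := weight_pos hk j
      have h3 : (0 : ℝ) < ρ := A.2.trans_lt ρ.2
      positivity
    obtain ⟨N, hN⟩ := hu ρ (((ρ : ℝ) ^ j)⁻¹ * weight k j * ε) (by positivity)
    refine ⟨N, fun m hm n hn => ?_⟩
    have h1 := (term_le_seminorm ρ (u m - u n) j).trans_lt (hN m hm n hn)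
    rw [map_sub] at h1
    exact lt_of_mul_lt_mul_left h1 hw.le
  choose P hP hlim using hcj
  have hdiff : ∀ n j, coeff j (u n) - P j ∈ Θ.poly j := fun n j =>
    Submodule.sub_mem _ (coeff_mem j _) (hP j)
  have hbound : ∀ (ρ : {ρ : ℝ // (A : ℝ) < ρ}), ∀ ε > 0, ∃ N, ∀ n ≥ N, ∀ J,
      ∑ j ∈ Finset.range J, ((ρ : ℝ) ^ j)⁻¹ * weight k j * Θ.norm j (coeff j (u n) - P j) ≤ ε := by
    intro ρ ε hε
    obtain ⟨N, hN⟩ := hu ρ ε hε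
    refine ⟨N, fun n hn J => ?_⟩
    have hw : ∀ j, 0 ≤ ((ρ : ℝ) ^ j)⁻¹ * weight k j := fun j => by
      have h2 := weight_nonneg k j
      have h3 : (0 : ℝ) ≤ ρ := A.2.trans ρ.2.le
      positivity
    have h1 : Tendsto (fun m => ε + ∑ j ∈ Finset.range J,
        ((ρ : ℝ) ^ j)⁻¹ * weight k j * Θ.norm j (coeff j (u m) - P j)) atTop (𝓝 (ε + 0)) := by
      refine tendsto_const_nhds.add ?_
      have := tendsto_finsetSum (Finset.range J) fun j _ =>
        (hlim j).const_mul (((ρ : ℝ) ^ j)⁻¹ * weight k j)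
      simpa using this
    rw [add_zero] at h1
    refine ge_of_tendsto h1 ?_
    filter_upwards [eventually_ge_atTop N] with m hm
    calc ∑ j ∈ Finset.range J, ((ρ : ℝ) ^ j)⁻¹ * weight k j * Θ.norm j (coeff j (u n) - P j)
        ≤ ∑ j ∈ Finset.range J, (((ρ : ℝ) ^ j)⁻¹ * weight k j * Θ.norm j (coeff j (u n - u m)) +
            ((ρ : ℝ) ^ j)⁻¹ * weight k j * Θ.norm j (coeff j (u m) - P j)) := by
          refine Finset.sum_le_sum fun j _ => ?_
          rw [← mul_add]
          refine mul_le_mul_of_nonneg_left ?_ (hw j)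
          have := Θ.norm_add_le j _ (coeff_mem j (u n - u m)) _ (hdiff m j)
          rw [map_sub, sub_add_sub_cancel] at this
          rwa [map_sub]
      _ ≤ _ := by
          rw [Finset.sum_add_distrib]
          gcongr
          exact ((isCoeff_coeff _).summable ρ ρ.2).sum_le_tsum _
            (fun j _ => term_nonneg ρ (coeff_mem j _)) |>.trans (hN n hn m hm).le
  have hsum : ∀ (ρ : {ρ : ℝ // (A : ℝ) < ρ}), ∃ n, Summable fun j =>
      ((ρ : ℝ) ^ j)⁻¹ * weight k j * Θ.norm j (coeff j (u n) - P j) := by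
    intro ρ
    obtain ⟨N, hN⟩ := hbound ρ 1 one_pos
    exact ⟨N, summable_of_sum_range_le (fun j => term_nonneg ρ (hdiff N j)) (hN N le_rfl)⟩
  have hPc : IsCoeff Θ k A P := by
    refine ⟨hP, fun ρ hρ => ?_⟩
    obtain ⟨n, hn⟩ := hsum ⟨ρ, hρ⟩
    refine Summable.of_nonneg_of_le (fun j => term_nonneg ⟨ρ, hρ⟩ (hP j)) (fun j => ?_)
      (((u n).isCoeff_coeff.summable ρ hρ).add hn)
    rw [← mul_add]
    have hw : 0 ≤ (ρ ^ j)⁻¹ * weight k j := by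
      have h2 := weight_nonneg k j
      have h3 : (0 : ℝ) ≤ ρ := A.2.trans hρ.le
      positivity
    refine mul_le_mul_of_nonneg_left ?_ hw
    have h1 := Θ.norm_add_le j _ (coeff_mem j (u n)) _ (Submodule.smul_mem _ (-1) (hdiff n j))
    rw [Θ.norm_smul j (-1) _ (hdiff n j)] at h1
    have h2 : coeff j (u n) + (-1 : ℂ) • (coeff j (u n) - P j) = P j := by
      rw [neg_one_smul]; abel
    rw [h2] at h1
    simpa using h1
  refine ⟨ofCoeff hcan hk hPc, ?_⟩
  rw [(withSeminorms Θ k A).tendsto_nhds_atTop]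
  intro ρ ε hε
  obtain ⟨N, hN⟩ := hbound ρ (ε / 2) (half_pos hε)
  refine ⟨N, fun n hn => lt_of_le_of_lt ?_ (half_lt_self hε)⟩
  rw [seminorm_apply]
  refine Real.tsum_le_of_sum_range_le (fun j => term_nonneg ρ (coeff_mem j _)) fun J => ?_
  simpa using hN n hn J

lemma baireSpace (hcan : Θ.HasCanonicalConstants) (hk : k ≠ 0) : BaireSpace (Exp Θ k A) := by
  let _ : UniformSpace (Exp Θ k A) := IsTopologicalAddGroup.rightUniformSpace _
  have : IsUniformAddGroup (Exp Θ k A) := isUniformAddGroup_of_addCommGroup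
  have : (uniformity (Exp Θ k A)).IsCountablyGenerated :=
    IsUniformAddGroup.uniformity_countably_generated
  have : CompleteSpace (Exp Θ k A) := by
    refine UniformSpace.complete_of_cauchySeq_tendsto fun u hu => ?_
    refine exists_tendsto_of_cauchy hcan hk fun ρ ε hε => ?_
    have h1 : Tendsto (fun q : ℕ × ℕ => u q.1 - u q.2) atTop (𝓝 0) := by
      have := hu.tendsto_uniformity
      rw [uniformity_eq_comap_nhds_zero_swapped, tendsto_comap_iff, ← prod_atTop_atTop_eq] at *
      exact this
    have h2 := (((withSeminorms Θ k A).continuous_seminorm ρ).tendsto 0).comp h1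
    rw [map_zero] at h2
    obtain ⟨⟨N, N'⟩, hN⟩ := eventually_atTop.1 (h2.eventually (gt_mem_nhds hε))
    exact ⟨max N N', fun m hm n hn =>
      hN (m, n) ⟨(le_max_left _ _).trans hm, (le_max_right _ _).trans hn⟩⟩
  infer_instance

lemma secondCountableTopology [TopologicalSpace.SeparableSpace (Exp Θ k A)] :
    SecondCountableTopology (Exp Θ k A) := by
  let _ : UniformSpace (Exp Θ k A) := IsTopologicalAddGroup.rightUniformSpace _
  have : IsUniformAddGroup (Exp Θ k A) := isUniformAddGroup_of_addCommGroup
  have : (uniformity (Exp Θ k A)).IsCountablyGenerated :=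
    IsUniformAddGroup.uniformity_countably_generated
  exact UniformSpace.secondCountable_of_separable _

/-! ### Homogeneous elements -/

lemma isCoeff_single {j : ℕ} {P : E → ℂ} (hP : P ∈ Θ.poly j) :
    IsCoeff Θ k A (fun i => if i = j then P else 0) := by
  refine ⟨fun i => ?_, fun ρ _ => ?_⟩
  · split_ifs with h
    · exact h ▸ hP
    · exact Submodule.zero_mem _
  · refine summable_of_ne_finset_zero (s := {j}) fun i hi => ?_
    rw [if_neg (by simpa using hi), Θ.norm_zero_eq, mul_zero]

/-- A homogeneous polynomial as an element of `Exp^k_{Θ,0,A}(E)`. -/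
noncomputable def homog (A : ℝ≥0) (hcan : Θ.HasCanonicalConstants) (hk : k ≠ 0) (j : ℕ) :
    Θ.poly j →ₗ[ℂ] Exp Θ k A where
  toFun P := ofCoeff hcan hk (isCoeff_single P.2)
  map_add' P Q := ext_coeff fun i => by
    simp only [map_add, coeff_ofCoeff]
    split_ifs <;> simp
  map_smul' c P := ext_coeff fun i => by
    simp only [map_smul, coeff_ofCoeff]
    split_ifs <;> simp

lemma coeff_homog (hcan : Θ.HasCanonicalConstants) (hk : k ≠ 0) (i j : ℕ) (P : Θ.poly j) :
    coeff i (homog A hcan hk j P) = if i = j then (P : E → ℂ) else 0 :=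
  coeff_ofCoeff hcan hk (isCoeff_single P.2) i

lemma seminorm_homog (hcan : Θ.HasCanonicalConstants) (hk : k ≠ 0) (ρ : {ρ : ℝ // (A : ℝ) < ρ})
    (j : ℕ) (P : Θ.poly j) :
    seminorm Θ k A ρ (homog A hcan hk j P) = ((ρ : ℝ) ^ j)⁻¹ * weight k j * Θ.norm j P := by
  rw [seminorm_apply, tsum_eq_single j]
  · rw [coeff_homog, if_pos rfl]
  · intro i hi
    rw [coeff_homog, if_neg hi, Θ.norm_zero_eq, mul_zero]

/-- The Taylor series at the origin converges in `Exp^k_{Θ,0,A}(E)`. -/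
lemma tendsto_sum_homog (hcan : Θ.HasCanonicalConstants) (hk : k ≠ 0) (f : Exp Θ k A) :
    Tendsto (fun N => ∑ j ∈ Finset.range N, homog A hcan hk j ⟨coeff j f, coeff_mem j f⟩) atTop
      (𝓝 f) := by
  rw [(withSeminorms Θ k A).tendsto_nhds_atTop]
  intro ρ ε hε
  have hs := f.isCoeff_coeff.summable ρ ρ.2
  have h1 := hs.hasSum.tendsto_sum_nat
  obtain ⟨N, hN⟩ := Metric.tendsto_atTop.1 h1 ε hε
  refine ⟨N, fun n hn => ?_⟩
  have h2 : ∀ i, coeff i (∑ j ∈ Finset.range n, homog A hcan hk j ⟨coeff j f, coeff_mem j f⟩ - f) =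
      if i < n then 0 else -coeff i f := by
    intro i
    simp only [map_sub, map_sum, coeff_homog, Finset.sum_ite_eq, Finset.mem_range]
    split_ifs <;> simp
  have h3 := hN n hn
  rw [Real.dist_eq, abs_sub_comm, ← hs.sum_add_tsum_nat_add n, add_sub_cancel_left] at h3
  refine lt_of_le_of_lt ?_ ((le_abs_self _).trans_lt h3)
  rw [seminorm_apply, ← (isCoeff_coeff _).summable ρ ρ.2 |>.sum_add_tsum_nat_add n]
  refine le_of_eq ?_
  rw [Finset.sum_eq_zero, zero_add]
  · refine tsum_congr fun i => ?_
    have h4 := Θ.norm_smul (i + n) (-1) _ (coeff_mem (i + n) f)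
    rw [h2, if_neg (by omega), ← neg_one_smul ℂ, h4]
    simp
  · intro i hi
    rw [h2, if_pos (Finset.mem_range.1 hi), Θ.norm_zero_eq, mul_zero]

/-- A continuous functional that vanishes on the powers of the elements of `E'` vanishes. -/
lemma eq_zero_of_homog_pow (hΘ : Θ.IsPiOne) (hcan : Θ.HasCanonicalConstants) (hk : k ≠ 0)
    (T : Exp Θ k A →L[ℂ] ℂ)
    (hT : ∀ (j : ℕ) (φ : StrongDual ℂ E) (h : (fun x => φ x ^ j) ∈ Θ.poly j),
      T (homog A hcan hk j ⟨fun x => φ x ^ j, h⟩) = 0) : T = 0 := by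
  obtain ⟨ρ, C, hC0, hC⟩ := exists_norm_le T
  have hfin : ∀ j, ∀ Q (hQ : Q ∈ finiteTypePoly E j),
      T (homog A hcan hk j ⟨Q, hΘ.finiteType_le j hQ⟩) = 0 := by
    intro j Q hQ
    induction hQ using Submodule.span_induction with
    | mem Q hQ =>
      obtain ⟨φ, b, rfl⟩ := hQ
      have h1 : (fun x => φ x ^ j) ∈ Θ.poly j :=
        hΘ.finiteType_le j (Submodule.subset_span ⟨φ, 1, by simp⟩)
      have h2 := hT j φ h1
      have h3 : T (homog A hcan hk j (b • ⟨fun x => φ x ^ j, h1⟩)) = 0 := by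
        rw [map_smul, map_smul, h2, smul_zero]
      convert h3 using 4
      funext x
      simp [mul_comm]
    | zero =>
      have h1 : T (homog A hcan hk j 0) = 0 := by rw [map_zero, map_zero]
      exact h1
    | add P Q hP hQ h1 h2 =>
      have h3 : T (homog A hcan hk j (⟨P, hΘ.finiteType_le j hP⟩ + ⟨Q, hΘ.finiteType_le j hQ⟩)) =
          0 := by rw [map_add, map_add, h1, h2, add_zero]
      exact h3
    | smul c P hP h1 =>
      have h3 : T (homog A hcan hk j (c • ⟨P, hΘ.finiteType_le j hP⟩)) = 0 := by
        rw [map_smul, map_smul, h1, smul_zero]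
      exact h3
  have hhom : ∀ j, ∀ P : Θ.poly j, T (homog A hcan hk j P) = 0 := by
    intro j P
    rw [← norm_le_zero_iff]
    have hw : 0 ≤ C * (((ρ : ℝ) ^ j)⁻¹ * weight k j) := by
      have h2 := weight_nonneg k j
      have h3 : (0 : ℝ) ≤ ρ := A.2.trans ρ.2.le
      positivity
    refine le_of_forall_pos_le_add fun ε hε => ?_
    obtain ⟨Q, hQ, hPQ⟩ := hΘ.dense j P P.2 (ε / (C * (((ρ : ℝ) ^ j)⁻¹ * weight k j) + 1))
      (by positivity)
    have h1 := hC (homog A hcan hk j (P - ⟨Q, hΘ.finiteType_le j hQ⟩))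
    rw [seminorm_homog, map_sub, map_sub, hfin j Q hQ, sub_zero, ← mul_assoc] at h1
    refine h1.trans ?_
    rw [zero_add]
    refine (mul_le_mul_of_nonneg_left hPQ.le hw).trans ?_
    rw [mul_div_assoc', div_le_iff₀ (by positivity)]
    nlinarith
  ext f
  have h1 := (T.continuous.tendsto f).comp (tendsto_sum_homog hcan hk f)
  refine tendsto_nhds_unique h1 ?_
  simp [Function.comp_def, map_sum, hhom]

end Exp

/-! ### Density by duality -/

/-- A set spans a dense subspace if only the zero functional vanishes on it. -/
lemma dense_span_of_forall_dual {X : Type*} [AddCommGroup X] [Module ℂ X] [TopologicalSpace X]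
    [IsTopologicalAddGroup X] [ContinuousSMul ℂ X] [LocallyConvexSpace ℝ X] {s : Set X}
    (h : ∀ T : X →L[ℂ] ℂ, (∀ x ∈ s, T x = 0) → T = 0) :
    Dense (Submodule.span ℂ s : Set X) := by
  have : ContinuousSMul ℝ X := IsScalarTower.continuousSMul ℂ
  rw [dense_iff_closure_eq, ← Submodule.topologicalClosure_coe]
  by_contra hne
  obtain ⟨x, hx⟩ := (Set.ne_univ_iff_exists_notMem _).1 hne
  set M := (Submodule.span ℂ s).topologicalClosure with hM
  obtain ⟨T, u, hTu, hux⟩ := RCLike.geometric_hahn_banach_closed_point (𝕜 := ℂ)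
    (s := (M : Set X)) (M.restrictScalars ℝ).convex
    (Submodule.isClosed_topologicalClosure _) hx
  have hu : 0 < u := by simpa using hTu 0 M.zero_mem
  -- A functional whose real part is bounded above on a subspace vanishes on it.
  have hT0 : ∀ y ∈ M, T y = 0 := by
    intro y hy
    by_contra hy0
    have h1 := hTu ((u / T y : ℂ) • y) (M.smul_mem _ hy)
    rw [map_smul, smul_eq_mul, div_mul_cancel₀ _ hy0] at h1
    simp at h1
  have h2 := h T fun y hy => hT0 y (Submodule.le_topologicalClosure _ (Submodule.subset_span hy))
  rw [h2] at hux
  simp at hux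
  linarith

/-! ### Mixing and hypercyclicity -/

section Dynamics

variable {X : Type*} [TopologicalSpace X]

/-- Birkhoff's transitivity theorem, for mixing maps: the points with dense orbit are the
intersection of countably many dense open sets. -/
lemma IsMixing.isHypercyclic [SecondCountableTopology X] [BaireSpace X] [Nonempty X] {T : X → X}
    (hT : Continuous T) (h : IsMixing T) : IsHypercyclic T := by
  let B := TopologicalSpace.countableBasis X
  have hB := TopologicalSpace.isBasis_countableBasis X
  have hdense : Dense (⋂ V ∈ B, ⋃ n : ℕ, T^[n] ⁻¹' V) := by
    refine dense_biInter_of_isOpen (fun V hV => ?_) (TopologicalSpace.countable_countableBasis X)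
      fun V hV => ?_
    · exact isOpen_iUnion fun n => (hB.isOpen hV).preimage (hT.iterate n)
    · rw [dense_iff_inter_open]
      intro U hU hUne
      obtain ⟨n, hn⟩ := h U V hU hUne (hB.isOpen hV)
        (TopologicalSpace.nonempty_of_mem_countableBasis hV)
      obtain ⟨y, ⟨x, hxU, rfl⟩, hxV⟩ := hn n le_rfl
      exact ⟨x, hxU, Set.mem_iUnion.2 ⟨n, hxV⟩⟩
  obtain ⟨x, hx⟩ := hdense.nonempty
  refine ⟨x, hB.dense_iff.2 fun V hV _ => ?_⟩
  obtain ⟨n, hn⟩ := Set.mem_iUnion.1 (Set.mem_iInter₂.1 hx V hV)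
  exact ⟨T^[n] x, hn, n, rfl⟩

/-- The criterion of Kitai, Godefroy and Shapiro: an operator is mixing if the eigenvectors with
eigenvalues of absolute value less than `1`, and those with eigenvalues of absolute value greater
than `1`, both span dense subspaces. -/
theorem isMixing_of_dense_eigenvectors [AddCommGroup X] [Module ℂ X] [IsTopologicalAddGroup X]
    [ContinuousSMul ℂ X] (L : X →L[ℂ] X)
    (h₁ : Dense (Submodule.span ℂ {v : X | ∃ c : ℂ, ‖c‖ < 1 ∧ L v = c • v} : Set X))
    (h₂ : Dense (Submodule.span ℂ {v : X | ∃ c : ℂ, 1 < ‖c‖ ∧ L v = c • v} : Set X)) :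
    IsMixing L := by
  have hiter : ∀ (n : ℕ) (c : ℂ) (v : X), L v = c • v → L^[n] v = c ^ n • v := by
    intro n c v hv
    induction n with
    | zero => simp
    | succ n ih => rw [Function.iterate_succ_apply', ih, map_smul, hv, smul_smul, pow_succ]
  have hadd : ∀ (n : ℕ) (x y : X), L^[n] (x + y) = L^[n] x + L^[n] y := fun n x y =>
    iterate_map_add L n x y
  have hsmul : ∀ (n : ℕ) (c : ℂ) (x : X), L^[n] (c • x) = c • L^[n] x := by
    intro n c x
    induction n with
    | zero => rfl
    | succ n ih => rw [Function.iterate_succ_apply', ih, map_smul, Function.iterate_succ_apply']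
  have hpow : ∀ (c : ℂ) (v : X), ‖c‖ < 1 → Tendsto (fun n : ℕ => c ^ n • v) atTop (𝓝 0) := by
    intro c v hc
    simpa using (tendsto_pow_atTop_nhds_zero_of_norm_lt_one hc).smul_const v
  -- The orbits of the vectors of the first subspace tend to zero.
  have hzero : ∀ x ∈ Submodule.span ℂ {v : X | ∃ c : ℂ, ‖c‖ < 1 ∧ L v = c • v},
      Tendsto (fun n => L^[n] x) atTop (𝓝 0) := by
    intro x hx
    induction hx using Submodule.span_induction with
    | mem v hv =>
      obtain ⟨c, hc, hv⟩ := hv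
      simpa only [hiter _ c v hv] using hpow c v hc
    | zero => simp [iterate_map_zero, tendsto_const_nhds]
    | add x y _ _ hx hy => simpa only [hadd, add_zero] using hx.add hy
    | smul c x _ hx => simpa only [hsmul, smul_zero] using hx.const_smul c
  -- The vectors of the second subspace have backward orbits that tend to zero.
  have hback : ∀ y ∈ Submodule.span ℂ {v : X | ∃ c : ℂ, 1 < ‖c‖ ∧ L v = c • v},
      ∃ w : ℕ → X, Tendsto w atTop (𝓝 0) ∧ ∀ n, L^[n] (w n) = y := by
    intro y hy
    induction hy using Submodule.span_induction with
    | mem v hv =>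
      obtain ⟨c, hc, hv⟩ := hv
      have hc0 : c ≠ 0 := norm_pos_iff.1 (zero_lt_one.trans hc)
      refine ⟨fun n => c⁻¹ ^ n • v, hpow _ _ ?_, fun n => ?_⟩
      · rw [norm_inv]
        exact inv_lt_one_of_one_lt₀ hc
      · rw [hsmul, hiter n c v hv, smul_smul, ← mul_pow, inv_mul_cancel₀ hc0, one_pow, one_smul]
    | zero => exact ⟨0, tendsto_const_nhds, fun n => by simp [iterate_map_zero]⟩
    | add x y _ _ hx hy =>
      obtain ⟨w, hw, hwx⟩ := hx
      obtain ⟨z, hz, hzy⟩ := hy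
      exact ⟨fun n => w n + z n, by simpa using hw.add hz, fun n => by rw [hadd, hwx, hzy]⟩
    | smul c x _ hx =>
      obtain ⟨w, hw, hwx⟩ := hx
      exact ⟨fun n => c • w n, by simpa using hw.const_smul c, fun n => by rw [hsmul, hwx]⟩
  intro U V hU hUne hV hVne
  obtain ⟨x, hxU, hx⟩ := h₁.inter_open_nonempty U hU hUne
  obtain ⟨y, hyV, hy⟩ := h₂.inter_open_nonempty V hV hVne
  obtain ⟨w, hw, hwy⟩ := hback y hy
  have hlim₁ : Tendsto (fun n => x + w n) atTop (𝓝 x) := by simpa using hw.const_add x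
  have hlim₂ : Tendsto (fun n => L^[n] (x + w n)) atTop (𝓝 y) := by
    simpa only [hadd, hwy, zero_add] using (hzero x hx).add_const y
  obtain ⟨n₀, hn₀⟩ := eventually_atTop.1 ((hlim₁.eventually (hU.mem_nhds hxU)).and
    (hlim₂.eventually (hV.mem_nhds hyV)))
  exact ⟨n₀, fun n hn => ⟨_, ⟨_, (hn₀ n hn).1, rfl⟩, (hn₀ n hn).2⟩⟩

end Dynamics

/-! ### Exponentials -/

lemma summable_pow_div_factorial_rpow {s : ℝ} (hs : 0 < s) {M : ℝ} (hM : 0 ≤ M) :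
    Summable fun j : ℕ => M ^ j / (j.factorial : ℝ) ^ s := by
  set N : ℝ := (2 * M) ^ s⁻¹ with hN
  have hN0 : 0 ≤ N := by positivity
  have hgeo : Summable fun j : ℕ => Real.exp N ^ s * (1 / 2 : ℝ) ^ j :=
    summable_geometric_two.mul_left _
  refine Summable.of_nonneg_of_le (fun j => by positivity) (fun j => ?_) hgeo
  have h1 : (N ^ j / j.factorial) ^ s ≤ Real.exp N ^ s :=
    Real.rpow_le_rpow (by positivity) (Real.pow_div_factorial_le_exp N hN0 j) hs.le
  have h2 : (N ^ j) ^ s = (2 * M) ^ j := by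
    rw [← Real.rpow_natCast, ← Real.rpow_mul hN0, mul_comm, Real.rpow_mul hN0, hN,
      ← Real.rpow_mul (y := s⁻¹) (by positivity), inv_mul_cancel₀ hs.ne', Real.rpow_one,
      Real.rpow_natCast]
  rw [Real.div_rpow (by positivity) (by positivity), h2] at h1
  calc M ^ j / (j.factorial : ℝ) ^ s
      = (2 * M) ^ j / (j.factorial : ℝ) ^ s * (1 / 2 : ℝ) ^ j := by
        rw [mul_pow, one_div, inv_pow]
        field_simp
    _ ≤ _ := by gcongr

lemma exists_weight_le (hk : 1 < k) :
    ∃ t : ℝ, t < 1 ∧ ∀ j : ℕ, weight k j ≤ (j.factorial : ℝ) ^ t := by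
  by_cases hk' : k = ∞
  · exact ⟨0, one_pos, fun j => by simp [weight, hk']⟩
  have hκ : 1 < k.toReal := by
    rw [← ENNReal.toReal_one]
    exact (ENNReal.toReal_lt_toReal ENNReal.one_ne_top hk').2 hk
  have hκ0 : 0 < k.toReal := one_pos.trans hκ
  refine ⟨1 / k.toReal, (div_lt_one hκ0).2 hκ, fun j => ?_⟩
  rw [weight, if_neg hk', show (j : ℝ) / k.toReal = (j : ℝ) * (1 / k.toReal) by ring,
    Real.rpow_mul (by positivity), Real.rpow_natCast]
  refine Real.rpow_le_rpow (by positivity) ?_ (by positivity)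
  have h1 := Real.pow_div_factorial_le_exp (j : ℝ) (by positivity) j
  rw [div_le_iff₀ (by positivity)] at h1
  calc ((j : ℝ) / (k.toReal * Real.exp 1)) ^ j ≤ ((j : ℝ) / (1 * Real.exp 1)) ^ j := by gcongr
    _ = (j : ℝ) ^ j / Real.exp j := by
        rw [one_mul, div_pow, ← Real.exp_nat_mul, mul_one]
    _ ≤ j.factorial := by
        rw [div_le_iff₀ (Real.exp_pos _)]
        linarith

/-- The coefficients of the exponential series are summable against the weights. Here `k > 1` is
needed. -/
lemma summable_weight_mul_pow_div_factorial (hk : 1 < k) {M : ℝ} (hM : 0 ≤ M) :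
    Summable fun j : ℕ => weight k j * (M ^ j / j.factorial) := by
  obtain ⟨t, ht, hw⟩ := exists_weight_le hk
  refine Summable.of_nonneg_of_le (fun j => ?_) (fun j => ?_)
    (summable_pow_div_factorial_rpow (sub_pos.2 ht) hM)
  · have := weight_nonneg k j
    positivity
  · have hj : (0 : ℝ) < j.factorial := by positivity
    calc weight k j * (M ^ j / j.factorial)
        ≤ (j.factorial : ℝ) ^ t * (M ^ j / j.factorial) := by
          gcongr
          exact hw j
      _ = M ^ j / (j.factorial : ℝ) ^ (1 - t) := by
          rw [Real.rpow_sub hj, Real.rpow_one]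
          field_simp

namespace HolomorphyType.IsPiOne

lemma pow_mem (hΘ : Θ.IsPiOne) (φ : StrongDual ℂ E) (j : ℕ) : (fun x => φ x ^ j) ∈ Θ.poly j :=
  hΘ.finiteType_le j (Submodule.subset_span ⟨φ, 1, by simp⟩)

end HolomorphyType.IsPiOne

lemma isCoeff_exp (hΘ : Θ.IsPiOne) (hk : 1 < k) (φ : StrongDual ℂ E) :
    IsCoeff Θ k A fun j => (j.factorial : ℂ)⁻¹ • fun x => φ x ^ j := by
  refine ⟨fun j => Submodule.smul_mem _ _ (hΘ.pow_mem φ j), fun ρ hρ => ?_⟩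
  obtain ⟨K, hK, hKn⟩ := hΘ.norm_pow_le
  have hρ0 : 0 < ρ := A.2.trans_lt hρ
  refine Summable.of_nonneg_of_le
    (fun j => Exp.term_nonneg ⟨ρ, hρ⟩ (Submodule.smul_mem _ _ (hΘ.pow_mem φ j))) (fun j => ?_)
    (summable_weight_mul_pow_div_factorial hk (M := ρ⁻¹ * K * ‖φ‖) (by positivity))
  have h1 := hKn φ 1 j
  simp only [mul_one, norm_one] at h1
  have h2 := weight_nonneg k j
  rw [Θ.norm_smul _ _ _ (hΘ.pow_mem φ j), norm_inv, Complex.norm_natCast]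
  calc (ρ ^ j)⁻¹ * weight k j * ((j.factorial : ℝ)⁻¹ * Θ.norm j fun x => φ x ^ j)
      ≤ (ρ ^ j)⁻¹ * weight k j * ((j.factorial : ℝ)⁻¹ * (K ^ j * ‖φ‖ ^ j)) := by gcongr
    _ = _ := by
        rw [mul_pow, mul_pow, inv_pow]
        ring

namespace Exp

variable (hΘ : Θ.IsPiOne) (hcan : Θ.HasCanonicalConstants) (hk : 1 < k)

/-- The exponential `x ↦ exp (φ x)`, as an element of `Exp^k_{Θ,0,A}(E)`. -/
noncomputable def expDual (A : ℝ≥0) (φ : StrongDual ℂ E) : Exp Θ k A :=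
  ofCoeff hcan (zero_lt_one.trans hk).ne' (isCoeff_exp hΘ hk φ)

lemma toFun_expDual (φ : StrongDual ℂ E) {x : E} (hx : x ∈ domain E k A) :
    (expDual hΘ hcan hk A φ).toFun x = Complex.exp (φ x) := by
  rw [expDual, toFun_ofCoeff _ _ _ hx, Complex.exp_eq_exp_ℂ, NormedSpace.exp_eq_tsum_div]
  refine tsum_congr fun j => ?_
  simp only [Pi.smul_apply, smul_eq_mul]
  ring

/-- The `j`-th power of `φ`, as an element of `Exp^k_{Θ,0,A}(E)`. -/
noncomputable def powDual (A : ℝ≥0) (j : ℕ) (φ : StrongDual ℂ E) : Exp Θ k A :=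
  homog A hcan (zero_lt_one.trans hk).ne' j ⟨fun x => φ x ^ j, hΘ.pow_mem φ j⟩

/-- A bound for the exponential series, locally uniform in `φ`. -/
lemma exists_summable_bound (T : Exp Θ k A →L[ℂ] ℂ) (r : ℝ) :
    ∃ b : ℕ → ℝ, Summable b ∧ ∀ (j : ℕ) (φ : StrongDual ℂ E), ‖φ‖ ≤ r →
      ‖(j.factorial : ℂ)⁻¹ * T (powDual hΘ hcan hk A j φ)‖ ≤ b j := by
  by_cases hr : 0 ≤ r
  · obtain ⟨ρ, C, hC0, hC⟩ := exists_norm_le T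
    obtain ⟨K, hK, hKn⟩ := hΘ.norm_pow_le
    have hρ0 : (0 : ℝ) < ρ := A.2.trans_lt ρ.2
    refine ⟨_, (summable_weight_mul_pow_div_factorial hk (M := (ρ : ℝ)⁻¹ * K * r)
      (by positivity)).mul_left C, fun j φ hφ => ?_⟩
    have h0 := hC (powDual hΘ hcan hk A j φ)
    rw [powDual, seminorm_homog] at h0
    have h1 := hKn φ 1 j
    simp only [mul_one, norm_one] at h1
    have h2 := weight_nonneg k j
    rw [norm_mul, norm_inv, Complex.norm_natCast]
    calc (j.factorial : ℝ)⁻¹ * ‖T (powDual hΘ hcan hk A j φ)‖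
        ≤ (j.factorial : ℝ)⁻¹ * (C * (((ρ : ℝ) ^ j)⁻¹ * weight k j * (K ^ j * r ^ j))) := by
          gcongr
          refine h0.trans ?_
          gcongr
          refine h1.trans ?_
          gcongr
      _ = _ := by
          rw [mul_pow, mul_pow, inv_pow]
          ring
  · exact ⟨0, summable_zero, fun j φ hφ => absurd ((norm_nonneg φ).trans hφ) hr⟩

lemma hasSum_expDual (T : Exp Θ k A →L[ℂ] ℂ) (φ : StrongDual ℂ E) :
    HasSum (fun j : ℕ => (j.factorial : ℂ)⁻¹ * T (powDual hΘ hcan hk A j φ))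
      (T (expDual hΘ hcan hk A φ)) := by
  obtain ⟨b, hb, hbT⟩ := exists_summable_bound hΘ hcan hk T ‖φ‖
  have hs : Summable fun j : ℕ => (j.factorial : ℂ)⁻¹ * T (powDual hΘ hcan hk A j φ) :=
    Summable.of_norm_bounded hb fun j => hbT j φ le_rfl
  have hk0 := (zero_lt_one.trans hk).ne'
  have h1 := (T.continuous.tendsto _).comp (tendsto_sum_homog hcan hk0 (expDual hΘ hcan hk A φ))
  have h2 : ∀ j, homog A hcan hk0 j ⟨coeff j (expDual hΘ hcan hk A φ), coeff_mem j _⟩ =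
      (j.factorial : ℂ)⁻¹ • powDual hΘ hcan hk A j φ := by
    intro j
    rw [powDual, ← map_smul]
    congr 1
    exact Subtype.ext (coeff_ofCoeff hcan hk0 (isCoeff_exp hΘ hk φ) j)
  simp only [Function.comp_def, map_sum, h2, map_smul, smul_eq_mul] at h1
  rw [← tendsto_nhds_unique hs.hasSum.tendsto_sum_nat h1]
  exact hs.hasSum

/-- Linear functionals of `(φ + z ψ) ^ j` are polynomials in `z`. -/
lemma differentiable_powDual_line (T : Exp Θ k A →L[ℂ] ℂ) (j : ℕ) (φ ψ : StrongDual ℂ E) :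
    Differentiable ℂ fun z : ℂ => T (powDual hΘ hcan hk A j (φ + z • ψ)) := by
  -- The mixed products `φ ^ i * ψ ^ (j - i)` are handled by an algebraic extension of `T` to all
  -- functions on `E`.
  obtain ⟨T', hT'⟩ := LinearMap.exists_extend
    ((T : Exp Θ k A →ₗ[ℂ] ℂ) ∘ₗ homog A hcan (zero_lt_one.trans hk).ne' j)
  have h1 : ∀ z : ℂ, T (powDual hΘ hcan hk A j (φ + z • ψ)) =
      ∑ i ∈ Finset.range (j + 1), z ^ (j - i) *
        T' ((j.choose i : ℂ) • fun x => φ x ^ i * ψ x ^ (j - i)) := by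
    intro z
    have h2 := LinearMap.congr_fun hT' ⟨fun x => (φ + z • ψ) x ^ j, hΘ.pow_mem _ j⟩
    have h3 : (fun x => (φ + z • ψ) x ^ j) = ∑ i ∈ Finset.range (j + 1),
        z ^ (j - i) • (j.choose i : ℂ) • fun x => φ x ^ i * ψ x ^ (j - i) := by
      funext x
      simp only [Finset.sum_apply, Pi.smul_apply, smul_eq_mul, add_apply,
        smul_apply, add_pow, mul_pow]
      exact Finset.sum_congr rfl fun i _ => by ring
    refine h2.symm.trans ?_
    change T' (fun x => (φ + z • ψ) x ^ j) = _
    rw [h3, map_sum]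
    exact Finset.sum_congr rfl fun i _ => by rw [map_smul, smul_eq_mul]
  simp only [h1]
  fun_prop

/-- The transform `φ ↦ T (exp φ)` of a functional is entire on complex lines. -/
lemma differentiable_expDual_line (T : Exp Θ k A →L[ℂ] ℂ) (φ ψ : StrongDual ℂ E) :
    Differentiable ℂ fun z : ℂ => T (expDual hΘ hcan hk A (φ + z • ψ)) := by
  intro z
  obtain ⟨b, hb, hbT⟩ := exists_summable_bound hΘ hcan hk T (‖φ‖ + (‖z‖ + 1) * ‖ψ‖)
  have h1 := Complex.differentiableOn_tsum_of_summable_norm hb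
    (F := fun (j : ℕ) (z : ℂ) =>
      (j.factorial : ℂ)⁻¹ * T (powDual hΘ hcan hk A j (φ + z • ψ)))
    (fun j => ((differentiable_powDual_line hΘ hcan hk T j φ ψ).const_mul _).differentiableOn)
    (Metric.isOpen_ball (x := (0 : ℂ)) (ε := ‖z‖ + 1)) (fun j w hw => by
      refine hbT j _ ((norm_add_le _ _).trans ?_)
      rw [norm_smul]
      rw [mem_ball_zero_iff] at hw
      gcongr)
  have h2 : (fun z : ℂ => T (expDual hΘ hcan hk A (φ + z • ψ))) =
      fun z => ∑' j : ℕ, (j.factorial : ℂ)⁻¹ * T (powDual hΘ hcan hk A j (φ + z • ψ)) :=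
    funext fun z => (hasSum_expDual hΘ hcan hk T _).tsum_eq.symm
  rw [h2]
  exact h1.differentiableAt (Metric.isOpen_ball.mem_nhds (by simp))

/-- The transform of a functional is continuous: it is locally bounded and entire on lines, so that
the Schwarz lemma applies. -/
lemma continuous_expDual (T : Exp Θ k A →L[ℂ] ℂ) :
    Continuous fun φ : StrongDual ℂ E => T (expDual hΘ hcan hk A φ) := by
  rw [continuous_iff_continuousAt]
  intro φ₀
  obtain ⟨b, hb, hbT⟩ := exists_summable_bound hΘ hcan hk T (‖φ₀‖ + 1)
  set M := ∑' j, b j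
  have hM : ∀ φ : StrongDual ℂ E, ‖φ - φ₀‖ ≤ 1 → ‖T (expDual hΘ hcan hk A φ)‖ ≤ M := by
    intro φ hφ
    have h1 : ‖φ‖ ≤ ‖φ₀‖ + 1 := by
      have := norm_add_le (φ - φ₀) φ₀
      rw [sub_add_cancel] at this
      linarith
    rw [← (hasSum_expDual hΘ hcan hk T φ).tsum_eq]
    exact tsum_of_norm_bounded hb.hasSum fun j => hbT j φ h1
  have hM0 : 0 ≤ M := (norm_nonneg _).trans (hM φ₀ (by simp))
  have hlip : ∀ φ : StrongDual ℂ E, ‖φ - φ₀‖ < 1 →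
      dist (T (expDual hΘ hcan hk A φ)) (T (expDual hΘ hcan hk A φ₀)) ≤
        (2 * M) * ‖φ - φ₀‖ := by
    intro φ hφ
    let d : ℂ := ((‖φ - φ₀‖ : ℝ) : ℂ)
    let ψ : StrongDual ℂ E := d⁻¹ • (φ - φ₀)
    have hd : ‖d‖ = ‖φ - φ₀‖ := by simp [d]
    have hψ : ‖ψ‖ ≤ 1 := by
      rw [norm_smul, norm_inv, hd]
      exact inv_mul_le_one
    have hdψ : φ₀ + d • ψ = φ := by
      by_cases h : φ - φ₀ = 0
      · simp [ψ, (sub_eq_zero.1 h).symm]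
      · have hd0 : d ≠ 0 := by
          rw [← norm_ne_zero_iff, hd]
          exact norm_ne_zero_iff.2 h
        rw [smul_smul, mul_inv_cancel₀ hd0, one_smul, add_sub_cancel]
    have hline : ∀ z : ℂ, ‖z‖ ≤ 1 → ‖T (expDual hΘ hcan hk A (φ₀ + z • ψ))‖ ≤ M := by
      intro z hz
      refine hM _ ?_
      rw [add_sub_cancel_left, norm_smul]
      exact mul_le_one₀ hz (norm_nonneg _) hψ
    have h1 := Complex.dist_le_div_mul_dist_of_mapsTo_ball
      (f := fun z : ℂ => T (expDual hΘ hcan hk A (φ₀ + z • ψ))) (c := 0) (R₁ := 1)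
      (R₂ := 2 * M) (z := d)
      (differentiable_expDual_line hΘ hcan hk T φ₀ ψ).differentiableOn ?_ ?_
    · simpa only [hdψ, hd, zero_smul ℂ ψ, add_zero, dist_zero_right, div_one] using h1
    · intro z hz
      rw [mem_ball_zero_iff] at hz
      have h2 := hline z hz.le
      have h3 := hline 0 (by simp)
      rw [Metric.mem_closedBall]
      refine (dist_le_norm_add_norm _ _).trans ?_
      linarith
    · rw [mem_ball_zero_iff, hd]
      exact hφ
  refine tendsto_iff_dist_tendsto_zero.2 ?_
  have h1 : Tendsto (fun φ : StrongDual ℂ E => (2 * M) * ‖φ - φ₀‖) (𝓝 φ₀) (𝓝 0) := by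
    have : Continuous fun φ : StrongDual ℂ E => (2 * M) * ‖φ - φ₀‖ := by fun_prop
    simpa using this.tendsto φ₀
  refine squeeze_zero' (Eventually.of_forall fun _ => dist_nonneg) ?_ h1
  filter_upwards [Metric.ball_mem_nhds φ₀ one_pos] with φ hφ
  exact hlip φ (by rwa [← dist_eq_norm])

/-- A functional is determined by its transform, because the powers of `φ` are the coefficients of
the expansion of `z ↦ exp (z φ)`. -/
lemma eq_zero_of_expDual (T : Exp Θ k A →L[ℂ] ℂ)
    (hT : ∀ φ : StrongDual ℂ E, T (expDual hΘ hcan hk A φ) = 0) : T = 0 := by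
  refine eq_zero_of_homog_pow hΘ hcan (zero_lt_one.trans hk).ne' T fun j φ _ => ?_
  change T (powDual hΘ hcan hk A j φ) = 0
  let c : ℕ → ℂ := fun j => (j.factorial : ℂ)⁻¹ * T (powDual hΘ hcan hk A j φ)
  have hz : ∀ z : ℂ, HasSum (fun j => z ^ j • c j) 0 := by
    intro z
    have h1 := hasSum_expDual hΘ hcan hk T (z • φ)
    rw [hT] at h1
    refine h1.congr_fun fun j => ?_
    have h2 : powDual hΘ hcan hk A j (z • φ) = z ^ j • powDual hΘ hcan hk A j φ := by
      rw [powDual, powDual, ← map_smul]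
      congr 1
      exact Subtype.ext (funext fun x => by simp [mul_pow])
    simp only [c, h2, map_smul, smul_eq_mul]
    ring
  let p : FormalMultilinearSeries ℂ ℂ ℂ :=
    fun n => ContinuousMultilinearMap.mkPiRing ℂ (Fin n) (c n)
  have hp : ∀ n, p.coeff n = c n := fun n => by
    simp [p, FormalMultilinearSeries.coeff]
  have hps : HasFPowerSeriesAt (0 : ℂ → ℂ) p 0 := by
    rw [hasFPowerSeriesAt_iff]
    exact Eventually.of_forall fun z => by
      simp only [hp]
      exact hz z
  have hc : c j = 0 := by
    rw [← hp, hps.eq_zero]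
    rfl
  exact (mul_eq_zero.1 hc).resolve_left (inv_ne_zero (Nat.cast_ne_zero.2 j.factorial_ne_zero))

lemma dense_span_expDual_of_dense {S : Set (StrongDual ℂ E)} (hS : Dense S) :
    Dense (Submodule.span ℂ (expDual hΘ hcan hk A '' S) : Set (Exp Θ k A)) := by
  refine dense_span_of_forall_dual fun T hT => eq_zero_of_expDual hΘ hcan hk T fun φ => ?_
  have h1 : (fun φ => T (expDual hΘ hcan hk A φ)) = fun _ => 0 :=
    (continuous_expDual hΘ hcan hk T).ext_on hS continuous_const fun φ hφ =>
      hT _ (Set.mem_image_of_mem _ hφ)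
  exact congrFun h1 φ

/-- By the identity theorem on lines, the exponentials of the elements of a set with nonempty
interior span a dense subspace. -/
lemma dense_span_expDual_of_mem_nhds {S : Set (StrongDual ℂ E)} {φ₀ : StrongDual ℂ E}
    (hS : S ∈ 𝓝 φ₀) :
    Dense (Submodule.span ℂ (expDual hΘ hcan hk A '' S) : Set (Exp Θ k A)) := by
  refine dense_span_of_forall_dual fun T hT => eq_zero_of_expDual hΘ hcan hk T fun φ => ?_
  have h1 : Differentiable ℂ fun z : ℂ => T (expDual hΘ hcan hk A (φ₀ + z • (φ - φ₀))) :=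
    differentiable_expDual_line hΘ hcan hk T φ₀ (φ - φ₀)
  have h2 : Continuous fun z : ℂ => φ₀ + z • (φ - φ₀) := by fun_prop
  have h3 : ∀ᶠ z : ℂ in 𝓝 0, φ₀ + z • (φ - φ₀) ∈ S :=
    h2.continuousAt.eventually_mem (by rwa [zero_smul ℂ (φ - φ₀), add_zero])
  have h4 : (fun z : ℂ => T (expDual hΘ hcan hk A (φ₀ + z • (φ - φ₀)))) = fun _ => 0 :=
    AnalyticOnNhd.eq_of_eventuallyEq (z₀ := 0) (fun z _ => h1.analyticAt z)
      (fun z _ => analyticAt_const)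
      (h3.mono fun z hz => hT _ (Set.mem_image_of_mem _ hz))
  have h5 := congrFun h4 1
  simpa using h5

include hΘ hcan hk in
lemma separableSpace [TopologicalSpace.SeparableSpace (StrongDual ℂ E)] :
    TopologicalSpace.SeparableSpace (Exp Θ k A) := by
  obtain ⟨S, hSc, hS⟩ := TopologicalSpace.exists_countable_dense (StrongDual ℂ E)
  have h1 : TopologicalSpace.IsSeparable
      (Submodule.span ℂ (expDual hΘ hcan hk A '' S) : Set (Exp Θ k A)) :=
    (hSc.image (expDual hΘ hcan hk A)).isSeparable.span
  rw [← TopologicalSpace.isSeparable_univ_iff,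
    ← (dense_span_expDual_of_dense hΘ hcan hk (A := A) hS).closure_eq]
  exact h1.closure

end Exp

/-! ### Convolution operators -/

section Convolution

variable (hΘ : Θ.IsPiOne) (hcan : Θ.HasCanonicalConstants) (hk : 1 < k)

/-- The exponentials are eigenvectors of a convolution operator: the image of `exp φ` solves the
differential equation `du = u φ`. -/
lemma IsConvolutionOperator.apply_expDual {L : Exp Θ k A →L[ℂ] Exp Θ k A}
    (hL : IsConvolutionOperator L) (φ : StrongDual ℂ E) :
    L (Exp.expDual hΘ hcan hk A φ) =
      Exp.evalZero (L (Exp.expDual hΘ hcan hk A φ)) • Exp.expDual hΘ hcan hk A φ := by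
  set f := Exp.expDual hΘ hcan hk A φ with hf
  have hffun : ∀ x ∈ domain E k A, f.toFun x = Complex.exp (φ x) := fun x hx =>
    Exp.toFun_expDual hΘ hcan hk φ hx
  have hfderiv : ∀ x ∈ domain E k A, ∀ a, fderiv ℂ (L f).toFun x a = φ a * (L f).toFun x := by
    intro x hx a
    have h1 := hL a f (φ a • f) (fun y hy => ?_) x hx
    · rw [h1, map_smul]
      rfl
    · have h2 : f.toFun =ᶠ[𝓝 y] fun x => Complex.exp (φ x) := by
        filter_upwards [(isOpen_domain k A).mem_nhds hy] with x hx using hffun x hx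
      have h3 : HasFDerivAt (fun x => Complex.exp (φ x)) (Complex.exp (φ y) • φ) y :=
        φ.hasFDerivAt.cexp
      rw [h2.fderiv_eq, h3.fderiv]
      change φ a * f.toFun y = _
      rw [hffun y hy]
      simp [mul_comm]
  have hdiff : ∀ x ∈ domain E k A, DifferentiableAt ℂ (L f).toFun x := fun x hx =>
    ((L f).memExp.holomorphic x hx).differentiableAt
  have hconst : ∀ x ∈ domain E k A, HasFDerivAt
      (fun x => (L f).toFun x * Complex.exp (-φ x)) (0 : E →L[ℂ] ℂ) x := by
    intro x hx
    have h1 : HasFDerivAt (fun x => Complex.exp (-φ x)) (Complex.exp (-φ x) • -φ) x :=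
      φ.hasFDerivAt.neg.cexp
    have h2 := (hdiff x hx).hasFDerivAt.mul h1
    refine h2.congr_fderiv ?_
    ext a
    simp [hfderiv x hx]
    ring
  refine Exp.ext_of_eqOn fun x hx => ?_
  have h1 := (isOpen_domain k A).is_const_of_fderiv_eq_zero (𝕜 := ℂ)
    (convex_domain k A).isPreconnected
    (fun x hx => (hconst x hx).differentiableAt.differentiableWithinAt)
    (fun x hx => (hconst x hx).fderiv) hx (zero_mem_domain k A)
  simp only [map_zero, neg_zero, Complex.exp_zero, mul_one] at h1
  change _ = (L f).toFun 0 * f.toFun x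
  rw [← h1, hffun x hx, mul_assoc, ← Complex.exp_add, neg_add_cancel, Complex.exp_zero, mul_one]

/-- An operator for which all exponentials are eigenvectors with one eigenvalue is a multiple of
the identity. -/
lemma eq_smul_of_apply_expDual {L : Exp Θ k A →L[ℂ] Exp Θ k A} {c : ℂ}
    (h : ∀ φ, L (Exp.expDual hΘ hcan hk A φ) = c • Exp.expDual hΘ hcan hk A φ)
    (f : Exp Θ k A) : L f = c • f := by
  have : T2Space (Exp Θ k A) := Exp.t2Space (zero_lt_one.trans hk).ne'
  have h1 : ∀ f ∈ Submodule.span ℂ (Exp.expDual hΘ hcan hk A '' Set.univ), L f = c • f := by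
    intro f hf
    induction hf using Submodule.span_induction with
    | mem f hf =>
      obtain ⟨φ, -, rfl⟩ := hf
      exact h φ
    | zero => simp
    | add f g _ _ hf hg => rw [map_add, hf, hg, smul_add]
    | smul b f _ hf => rw [map_smul, hf, smul_comm]
  exact congrFun (L.continuous.ext_on (Exp.dense_span_expDual_of_dense hΘ hcan hk dense_univ)
    (continuous_const_smul c) h1) f

/-- A function on `E'` that is entire on lines and not constant has values in the open unit
disc and values outside of the closed unit disc, by Liouville's theorem. -/
lemma exists_norm_lt_one_and_one_lt_norm {F : Type*} [AddCommGroup F] [Module ℂ F] {B : F → ℂ}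
    (hB : ∀ φ ψ, Differentiable ℂ fun z : ℂ => B (φ + z • ψ)) (hne : ¬ ∃ c, ∀ φ, B φ = c) :
    (∃ φ, ‖B φ‖ < 1) ∧ ∃ φ, 1 < ‖B φ‖ := by
  constructor
  · by_contra! h
    refine hne ⟨B 0, fun φ => ?_⟩
    have h0 : ∀ φ, B φ ≠ 0 := fun φ => norm_pos_iff.1 (zero_lt_one.trans_le (h φ))
    have h1 : Differentiable ℂ fun z : ℂ => (B (0 + z • φ))⁻¹ := (hB 0 φ).inv fun z => h0 _
    have h2 := h1.apply_eq_apply_of_bounded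
      (isBounded_iff_forall_norm_le.2 ⟨1, by
        rintro _ ⟨z, rfl⟩
        rw [norm_inv]
        exact inv_le_one_of_one_le₀ (h _)⟩) 1 0
    simpa using h2
  · by_contra! h
    refine hne ⟨B 0, fun φ => ?_⟩
    have h2 := (hB 0 φ).apply_eq_apply_of_bounded
      (isBounded_iff_forall_norm_le.2 ⟨1, by
        rintro _ ⟨z, rfl⟩
        exact h _⟩) 1 0
    simpa using h2

end Convolution

end HoloConv

theorem theorem4p9 {E : Type*} [NormedAddCommGroup E] [NormedSpace ℂ E] [CompleteSpace E]
    [TopologicalSpace.SeparableSpace (StrongDual ℂ E)]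
    (k : ℝ≥0∞) (hk : 1 < k) (A : ℝ≥0)
    (Θ : HoloConv.HolomorphyType E) (hΘ : Θ.IsPiOne) (hcan : Θ.HasCanonicalConstants)
    (L : HoloConv.Exp Θ k A →L[ℂ] HoloConv.Exp Θ k A) (hL : HoloConv.IsConvolutionOperator L)
    (hnt : ¬ ∃ c : ℂ, ∀ f : HoloConv.Exp Θ k A, L f = c • f) :
    HoloConv.IsMixing L ∧ HoloConv.IsHypercyclic L := by
  let T : HoloConv.Exp Θ k A →L[ℂ] ℂ := HoloConv.Exp.evalZero.comp L
  let B : StrongDual ℂ E → ℂ := fun φ => T (HoloConv.Exp.expDual hΘ hcan hk A φ)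
  have hLexp : ∀ φ, L (HoloConv.Exp.expDual hΘ hcan hk A φ) =
      B φ • HoloConv.Exp.expDual hΘ hcan hk A φ := hL.apply_expDual hΘ hcan hk
  have hBcont : Continuous B := HoloConv.Exp.continuous_expDual hΘ hcan hk T
  have hBne : ¬ ∃ c, ∀ φ, B φ = c := fun ⟨c, hc⟩ => hnt ⟨c,
    HoloConv.eq_smul_of_apply_expDual hΘ hcan hk fun φ => by rw [hLexp, hc]⟩
  obtain ⟨⟨φ₁, hφ₁⟩, ⟨φ₂, hφ₂⟩⟩ := HoloConv.exists_norm_lt_one_and_one_lt_norm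
    (HoloConv.Exp.differentiable_expDual_line hΘ hcan hk T) hBne
  have hmix : HoloConv.IsMixing L := by
    refine HoloConv.isMixing_of_dense_eigenvectors L ?_ ?_
    · refine (HoloConv.Exp.dense_span_expDual_of_mem_nhds hΘ hcan hk
        ((isOpen_lt hBcont.norm continuous_const).mem_nhds hφ₁)).mono (Submodule.span_mono ?_)
      rintro _ ⟨φ, hφ, rfl⟩
      exact ⟨B φ, hφ, hLexp φ⟩
    · refine (HoloConv.Exp.dense_span_expDual_of_mem_nhds hΘ hcan hk
        ((isOpen_lt continuous_const hBcont.norm).mem_nhds hφ₂)).mono (Submodule.span_mono ?_)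
      rintro _ ⟨φ, hφ, rfl⟩
      exact ⟨B φ, hφ, hLexp φ⟩
  have := HoloConv.Exp.baireSpace (A := A) hcan (zero_lt_one.trans hk).ne'
  have := HoloConv.Exp.separableSpace (A := A) hΘ hcan hk
  have : SecondCountableTopology (HoloConv.Exp Θ k A) := HoloConv.Exp.secondCountableTopology
  exact ⟨hmix, hmix.isHypercyclic L.continuous⟩
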